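/- Let $\Omega=\Omega_1\times\cdots\times\Omega_d$ be a product of (bounded or unbounded) intervals, let $\mu=\mu_1\otimes\cdots\otimes\mu_d$, where $\mu_i$ is a finite Borel measure on $\Omega_i$ with finite moments of all orders, and let $u:\mathbb{R}^d\to\mathbb{R}$ be $C^\infty$ (for instance a functional tensor train). For $v\in L^2_\mu(\Omega)$ and $1\le k\le d-1$, an orthogonalization of $v$ in the $k$-th variable is an expansion $$v(x)=Q_{\le k}\,\Sigma_k\,Q_{>k}=\sum_{\alpha=1}^{r_k} q_{k,\alpha}(x_1,\dots,x_k)\,\sigma_k(\alpha)\,p_{k,\alpha}(x_{k+1},\dots,x_d)\quad\text{in } L^2_\mu(\Omega),\qquad \sigma_k(\alpha)>0,\quad r_k\le\infty,$$ with $(q_{k,\alpha})_\alpha$ orthonormal in $L^2(\mu_1\otimes\cdots\otimes\mu_k)$ and $(p_{k,\alpha})_\alpha$ orthonormal in $L^2(\mu_{k+1}\otimes\cdots\otimes\mu_d)$. The $\sigma_k(\alpha)$ are the multilinear singular values of $v$; let $S(v)=\sum_{k=1}^{d-1}\sum_\alpha\sigma_k(\alpha)$ be their sum, and let $C(A)=S(u\circ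 A)$ for $A\in \mathrm{SL}_d(\mathbb{R})$. Give $\mathrm{SL}_d(\mathbb{R})$ the right-invariant metric $(V,W)_A=\mathrm{tr}\big[(VA^{-1})(WA^{-1})^{\top}\big]$ on the tangent spaces $T_A\mathrm{SL}_d(\mathbb{R})=\{NA:\mathrm{tr}\,N=0\}$. The Riemannian gradient $\mathrm{grad}\,C(A)$ is the unique $G\in T_A\mathrm{SL}_d(\mathbb{R})$ such that for every $V\in T_A\mathrm{SL}_d(\mathbb{R})$ and every smooth curve $\Theta$ on $\mathrm{SL}_d(\mathbb{R})$ with $\Theta(0)=A$ and $\Theta'(0)=V$ one has $\frac{d}{d\epsilon}C(\Theta(\epsilon))\big|_{\epsilon=0}=(G,V)_A$. Let $A\in\mathrm{SL}_d(\mathbb{R})$ be such that the derivatives of $u$ of each order $n$ grow at most polynomially on the transformed domain, i.e. $\|D^nu(Bx)\|\le K_n(1+\|x\|)^{m_n}$ for all $x\in\Omega$ and all $B\in\mathrm{SL}_d(\mathbb{R})$ near $A$ (automatic if $\Omega$ is bounded). Suppose that $C$ is finite near $A$ and differentiable at $A$ along every smooth curve on $\mathrm{SL}_d(\mathbb{R})$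 through $A$. Put $v(x)=u(Ax)$, let $g(x)=(\nabla u)(Ax)$ be the gradient of $u$ evaluated at $Ax$, and take any orthogonalizations $v=Q_{\le k}\Sigma_kQ_{>k}$, $k=1,\dots,d-1$. Then the matrix $$D=\sum_{k=1}^{d-1}\int_\Omega Q_{\le k}Q_{>k}\Big(g(x)(Ax)^{\top}-\frac{g(x)^{\top}Ax}{d}\,I_{d\times d}\Big)\,d\mu(x)$$ $$\phantom{D}:=\sum_{k=1}^{d-1}\sum_{\alpha=1}^{r_k}\int_\Omega q_{k,\alpha}\,p_{k,\alpha}\Big(g(x)(Ax)^{\top}-\frac{g(x)^{\top}Ax}{d}\,I_{d\times d}\Big)\,d\mu(x)$$ is well defined (the integrals and the sums over $\alpha$ converge absolutely), $\mathrm{tr}\,D=0$, and $$\mathrm{grad}\,C(A)=D\,A .$$ -/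

import Mathlib

open MeasureTheory Filter Topology Matrix
open scoped ENNReal ContDiff

/-- The coordinates `x_1, …, x_k` of a point of `ℝ^d`. -/
abbrev LeftIdx (d k : ℕ) : Type := {j : Fin d // (j : ℕ) < k}

/-- The coordinates `x_{k+1}, …, x_d` of a point of `ℝ^d`. -/
abbrev RightIdx (d k : ℕ) : Type := {j : Fin d // k ≤ (j : ℕ)}

/-- The variables `x_{≤ k}`. -/
def leftVars {d : ℕ} (k : ℕ) (x : Fin d → ℝ) : LeftIdx d k → ℝ := fun j => x j.1

/-- The variables `x_{> k}`. -/
def rightVars {d : ℕ} (k : ℕ) (x : Fin d → ℝ) : RightIdx d k → ℝ := fun j => x j.1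

/-- The product measure `μ = μ_1 ⊗ ⋯ ⊗ μ_d`. -/
noncomputable def prodMeasure {d : ℕ} (μ : Fin d → Measure ℝ) : Measure (Fin d → ℝ) :=
  Measure.pi μ

/-- The product measure `μ_{≤ k}` in the variables `x_{≤ k}`. -/
noncomputable def leftMeasure {d : ℕ} (μ : Fin d → Measure ℝ) (k : ℕ) :
    Measure (LeftIdx d k → ℝ) :=
  Measure.pi fun j : LeftIdx d k => μ j.1

/-- The product measure `μ_{> k}` in the variables `x_{> k}`. -/
noncomputable def rightMeasure {d : ℕ} (μ : Fin d → Measure ℝ) (k : ℕ) :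
    Measure (RightIdx d k → ℝ) :=
  Measure.pi fun j : RightIdx d k => μ j.1

/-- The index set `{0, 1, …, r - 1}` of length `r`, which may be infinite. -/
abbrev RankIdx (r : ℕ∞) : Type := {n : ℕ // (n : ℕ∞) < r}

/-- An orthogonalization `v = Q_{≤ k} Σ_k Q_{> k}` of `v ∈ L²_μ` in the `k`-th variable:
`q` is the row `Q_{≤ k}` of functions of `x_{≤ k}`, `p` is the column `Q_{> k}` of functions of
`x_{> k}`, both orthonormal, and `σ` is the diagonal of `Σ_k`, the (nonzero) singular values.
The rank may be finite or infinite; the series converges in `L²_μ` (for a finite rank this is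
equality almost everywhere). -/
structure FTTOrthogonalization {d : ℕ} (μ : Fin d → Measure ℝ) (v : (Fin d → ℝ) → ℝ)
    (k : ℕ) where
  /-- the rank `r_k` -/
  rank : ℕ∞
  /-- the singular values -/
  σ : RankIdx rank → ℝ
  /-- the entries of `Q_{≤ k}` -/
  q : RankIdx rank → (LeftIdx d k → ℝ) → ℝ
  /-- the entries of `Q_{> k}` -/
  p : RankIdx rank → (RightIdx d k → ℝ) → ℝ
  σ_pos : ∀ α, 0 < σ α
  memLp_v : MemLp v 2 (prodMeasure μ)
  memLp_q : ∀ α, MemLp (q α) 2 (leftMeasure μ k)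
  memLp_p : ∀ α, MemLp (p α) 2 (rightMeasure μ k)
  orthonormal_q : ∀ α β, ∫ y, q α y * q β y ∂(leftMeasure μ k) = if α = β then 1 else 0
  orthonormal_p : ∀ α β, ∫ z, p α z * p β z ∂(rightMeasure μ k) = if α = β then 1 else 0
  expansion : Tendsto
    (fun s : Finset (RankIdx rank) =>
      eLpNorm (fun x => v x - ∑ α ∈ s, q α (leftVars k x) * σ α * p α (rightVars k x)) 2
        (prodMeasure μ))
    atTop (𝓝 0)

/-- `S_k(v)`, the sum of the singular values of `v` in the `k`-th variable. The singular values do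
not depend on the orthogonalization, so the infimum is over a single value; it is `∞` if `v` has no
orthogonalization, that is, if `v` is not in `L²_μ`. -/
noncomputable def singularSum {d : ℕ} (μ : Fin d → Measure ℝ) (k : ℕ)
    (v : (Fin d → ℝ) → ℝ) : ℝ≥0∞ :=
  ⨅ O : FTTOrthogonalization μ v k, ∑' α, ENNReal.ofReal (O.σ α)

/-- `S(v)`, the sum over `k = 1, …, d - 1` of all multilinear singular values of `v`. -/
noncomputable def totalSingularSum {d : ℕ} (μ : Fin d → Measure ℝ)
    (v : (Fin d → ℝ) → ℝ) : ℝ≥0∞ :=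
  ∑ i : Fin (d - 1), singularSum μ ((i : ℕ) + 1) v

/-- The ridge function `x ↦ u (A x)`. -/
def ridge {d : ℕ} (u : (Fin d → ℝ) → ℝ) (A : SpecialLinearGroup (Fin d) ℝ) :
    (Fin d → ℝ) → ℝ :=
  fun x => u ((A : Matrix (Fin d) (Fin d) ℝ) *ᵥ x)

/-- The cost `C(A) = S(u ∘ A)` on `SL_d(ℝ)`. -/
noncomputable def cost {d : ℕ} (μ : Fin d → Measure ℝ) (u : (Fin d → ℝ) → ℝ)
    (A : SpecialLinearGroup (Fin d) ℝ) : ℝ :=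
  (totalSingularSum μ (ridge u A)).toReal

/-- The tangent space `T_A SL_d(ℝ) = 𝔰𝔩_d(ℝ) A`. -/
def tangentSL {d : ℕ} (A : SpecialLinearGroup (Fin d) ℝ) : Set (Matrix (Fin d) (Fin d) ℝ) :=
  {V | ∃ N : Matrix (Fin d) (Fin d) ℝ, N.trace = 0 ∧ V = N * (A : Matrix (Fin d) (Fin d) ℝ)}

/-- The right-invariant metric `(V, W)_A = tr [(V A⁻¹) (W A⁻¹)ᵀ]`. -/
noncomputable def metricSL {d : ℕ} (A : SpecialLinearGroup (Fin d) ℝ)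
    (V W : Matrix (Fin d) (Fin d) ℝ) : ℝ :=
  ((V * (A : Matrix (Fin d) (Fin d) ℝ)⁻¹) * (W * (A : Matrix (Fin d) (Fin d) ℝ)⁻¹)ᵀ).trace

/-- `Θ` is a smooth curve on `SL_d(ℝ)` that passes through `A` at `ε = 0` with velocity `V`. -/
def IsSmoothCurveThrough {d : ℕ} (Θ : ℝ → SpecialLinearGroup (Fin d) ℝ)
    (A : SpecialLinearGroup (Fin d) ℝ) (V : Matrix (Fin d) (Fin d) ℝ) : Prop :=
  (∀ j l, ContDiff ℝ ∞ fun ε => (Θ ε : Matrix (Fin d) (Fin d) ℝ) j l) ∧ Θ 0 = A ∧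
    ∀ j l, deriv (fun ε => (Θ ε : Matrix (Fin d) (Fin d) ℝ) j l) 0 = V j l

/-- `f` has a derivative at `A` along every smooth curve on `SL_d(ℝ)` through `A`. -/
def DifferentiableAlongCurves {d : ℕ} (f : SpecialLinearGroup (Fin d) ℝ → ℝ)
    (A : SpecialLinearGroup (Fin d) ℝ) : Prop :=
  ∀ V Θ, IsSmoothCurveThrough Θ A V → DifferentiableAt ℝ (fun ε => f (Θ ε)) 0

/-- `G` is a Riemannian gradient of `f` at `A`: a tangent vector at `A` with
`(d_A f) V = (G, V)_A` for all `V` in the tangent space at `A`, where `(d_A f) V` is the derivative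
of `f` along any smooth curve on `SL_d(ℝ)` through `A` with velocity `V`. -/
def IsRiemannianGradient {d : ℕ} (f : SpecialLinearGroup (Fin d) ℝ → ℝ)
    (A : SpecialLinearGroup (Fin d) ℝ) (G : Matrix (Fin d) (Fin d) ℝ) : Prop :=
  G ∈ tangentSL A ∧ ∀ V ∈ tangentSL A, ∀ Θ, IsSmoothCurveThrough Θ A V →
    HasDerivAt (fun ε => f (Θ ε)) (metricSL A G V) 0

/-- The column vector of partial derivatives of `u` at `y`. -/
noncomputable def grad {d : ℕ} (u : (Fin d → ℝ) → ℝ) (y : Fin d → ℝ) : Fin d → ℝ :=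
  fun j => fderiv ℝ u y (Pi.single j 1)

/-- The matrix `g (A x)ᵀ - (gᵀ A x / d) I`, where `g` is the gradient of `u` at the point `A x`. -/
noncomputable def descentMatrix {d : ℕ} (u : (Fin d → ℝ) → ℝ)
    (A : SpecialLinearGroup (Fin d) ℝ) (x : Fin d → ℝ) : Matrix (Fin d) (Fin d) ℝ :=
  let y : Fin d → ℝ := (A : Matrix (Fin d) (Fin d) ℝ) *ᵥ x
  vecMulVec (grad u y) y - ((grad u y ⬝ᵥ y) / (d : ℝ)) • (1 : Matrix (Fin d) (Fin d) ℝ)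

/-- The `(j, l)` entry of the function `q_α(x_{≤ k}) p_α(x_{> k}) M(x)`, with `M` as in
`descentMatrix`. Summed over `α` this is the entry of `Q_{≤ k} Q_{> k} M`. -/
noncomputable def descentTerm {d : ℕ} {μ : Fin d → Measure ℝ} {v : (Fin d → ℝ) → ℝ} {k : ℕ}
    (O : FTTOrthogonalization μ v k) (u : (Fin d → ℝ) → ℝ) (A : SpecialLinearGroup (Fin d) ℝ)
    (α : RankIdx O.rank) (j l : Fin d) (x : Fin d → ℝ) : ℝ :=
  O.q α (leftVars k x) * O.p α (rightVars k x) * descentMatrix u A x j l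

/-- The matrix `D = ∑_{k=1}^{d-1} ∫ Q_{≤ k} Q_{> k} M dμ`, the product `Q_{≤ k} Q_{> k}` being the
sum over the singular values, which is taken outside the integral. -/
noncomputable def descentGenerator {d : ℕ} {μ : Fin d → Measure ℝ} (u : (Fin d → ℝ) → ℝ)
    (A : SpecialLinearGroup (Fin d) ℝ)
    (O : ∀ i : Fin (d - 1), FTTOrthogonalization μ (ridge u A) ((i : ℕ) + 1)) :
    Matrix (Fin d) (Fin d) ℝ :=
  Matrix.of fun j l =>
    ∑ i : Fin (d - 1), ∑' α, ∫ x, descentTerm (O i) u A α j l x ∂(prodMeasure μ)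

/-! ### Splitting the variables -/

/-! The sum of the singular values in the `k`-th variable is a nuclear norm, hence a supremum of
linear functionals. If `q_α ⊗ p_α` are the terms of an orthogonalization of `v = u ∘ A`, a finite
sum of them is the kernel of a partial isometry, so pairing it with any `w` gives at most the
nuclear norm of `w` (`sum_integral_mul_term_le_singularSum`). For `w = v` the pairings with the
individual terms are the `σ_α`, and the supremum over finite sums is attained in the limit
(`singularSum_toReal`).

Keep these terms fixed and let `w = u ∘ Θ(ε)`. The pairing is a smooth function of `ε`, and Taylor's
formula yields `C(Θ(ε)) ≥ C(A) + ε ℓ - c ε²`, where `ℓ` is the sum of the pairings with the velocity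
of `u ∘ Θ` at `0`. Thus a smooth function touches the cost from below at `ε = 0`. As the cost is
assumed differentiable along `Θ`, its derivative must be `ℓ` (`hasDerivAt_cost`). No perturbation
theory of singular values or singular functions is involved, and multiplicities do no harm.

The rank may be infinite, so convergence of `ℓ` and a remainder uniform over finite sums need a
bound on `∑ |∫ f q_α p_α|` by derivatives of `f` (`exists_sum_abs_integral_mul_term_le`). The
fundamental theorem of calculus in each of `x_1, …, x_k` writes `f` as a superposition of products
of a function of `x_{≤ k}` and a function of `x_{> k}`; for each product, Cauchy–Schwarz and Bessel
bound the sum by the product of the `L²` norms.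

Finally `ℓ` is linear in `N`, where `Θ'(0) = N A`, and equals the Frobenius pairing of `N` with `D`,
which is the metric between `D A` and `N A`. The multiple of the identity in `D` is invisible to
traceless `N` and makes `D` traceless. -/

theorem measurePreserving_subtype_prod {ι : Type*} [Fintype ι] (μ : ι → Measure ℝ)
    [∀ i, SigmaFinite (μ i)] (p r : ι → Prop) (h : r = fun i => ¬ p i)
    [i₁ : Fintype (Subtype p)] [i₂ : Fintype (Subtype r)] :
    MeasurePreserving
      (fun x : ι → ℝ => ((fun j : Subtype p => x j.1), (fun j : Subtype r => x j.1)))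
      (Measure.pi μ)
      ((Measure.pi fun j : Subtype p => μ j.1).prod (Measure.pi fun j : Subtype r => μ j.1)) := by
  classical
  -- The predicate `r` and both `Fintype` instances are left free so that the result applies to `j <
  -- k` and `k ≤ j` as they stand; the instances are reconciled by `convert`.
  subst h
  convert measurePreserving_piEquivPiSubtypeProd μ p <;> rfl

theorem measurePreserving_leftVars_rightVars {d : ℕ} (μ : Fin d → Measure ℝ)
    [∀ i, IsFiniteMeasure (μ i)] (k : ℕ) :
    MeasurePreserving (fun x => (leftVars k x, rightVars k x)) (prodMeasure μ)
      ((leftMeasure μ k).prod (rightMeasure μ k)) :=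
  measurePreserving_subtype_prod μ (fun j : Fin d => (j : ℕ) < k) (fun j : Fin d => k ≤ (j : ℕ))
    (by ext; simp)

instance {d : ℕ} (μ : Fin d → Measure ℝ) [∀ i, IsFiniteMeasure (μ i)] :
    IsFiniteMeasure (prodMeasure μ) := by unfold prodMeasure; infer_instance

instance {d : ℕ} (μ : Fin d → Measure ℝ) [∀ i, IsFiniteMeasure (μ i)] (k : ℕ) :
    IsFiniteMeasure (leftMeasure μ k) := by unfold leftMeasure; infer_instance

instance {d : ℕ} (μ : Fin d → Measure ℝ) [∀ i, IsFiniteMeasure (μ i)] (k : ℕ) :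
    IsFiniteMeasure (rightMeasure μ k) := by unfold rightMeasure; infer_instance

section Split

variable {d : ℕ} {μ : Fin d → Measure ℝ} [∀ i, IsFiniteMeasure (μ i)] {k : ℕ}

theorem integral_left_mul_right (a : (LeftIdx d k → ℝ) → ℝ) (b : (RightIdx d k → ℝ) → ℝ)
    (ha : AEStronglyMeasurable a (leftMeasure μ k))
    (hb : AEStronglyMeasurable b (rightMeasure μ k)) :
    ∫ x, a (leftVars k x) * b (rightVars k x) ∂(prodMeasure μ) =
      (∫ y, a y ∂(leftMeasure μ k)) * ∫ z, b z ∂(rightMeasure μ k) := by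
  have h := measurePreserving_leftVars_rightVars μ k
  rw [← integral_prod_mul, ← h.map_eq, integral_map h.measurable.aemeasurable]
  rw [h.map_eq]
  exact ha.comp_fst.mul hb.comp_snd

theorem memLp_left_mul_right {a : (LeftIdx d k → ℝ) → ℝ} {b : (RightIdx d k → ℝ) → ℝ}
    (ha : MemLp a 2 (leftMeasure μ k)) (hb : MemLp b 2 (rightMeasure μ k)) :
    MemLp (fun x => a (leftVars k x) * b (rightVars k x)) 2 (prodMeasure μ) := by
  have h := measurePreserving_leftVars_rightVars μ k
  have h2 : MemLp (fun y : (LeftIdx d k → ℝ) × (RightIdx d k → ℝ) => a y.1 * b y.2) 2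
      ((leftMeasure μ k).prod (rightMeasure μ k)) := by
    have hm : AEStronglyMeasurable
        (fun y : (LeftIdx d k → ℝ) × (RightIdx d k → ℝ) => a y.1 * b y.2)
        ((leftMeasure μ k).prod (rightMeasure μ k)) := ha.1.comp_fst.mul hb.1.comp_snd
    rw [memLp_two_iff_integrable_sq hm]
    simpa only [mul_pow] using ha.integrable_sq.mul_prod hb.integrable_sq
  exact h2.comp_measurePreserving h

end Split

/-! ### Bessel's inequality -/

section Bessel

variable {X α : Type*} [MeasurableSpace X] {ν : Measure X} [DecidableEq α]

theorem orthonormal_toLp {q : α → X → ℝ} (hq : ∀ i, MemLp (q i) 2 ν)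
    (ho : ∀ i j, ∫ y, q i y * q j y ∂ν = if i = j then 1 else 0) :
    Orthonormal ℝ fun i => (hq i).toLp (q i) := by
  rw [orthonormal_iff_ite]
  intro i j
  rw [L2.inner_def, ← ho i j]
  refine integral_congr_ae ?_
  filter_upwards [(hq i).coeFn_toLp, (hq j).coeFn_toLp] with x h1 h2
  simp [h1, h2, mul_comm]

theorem sum_sq_integral_mul_le {q : α → X → ℝ} (hq : ∀ i, MemLp (q i) 2 ν)
    (ho : ∀ i j, ∫ y, q i y * q j y ∂ν = if i = j then 1 else 0) {a : X → ℝ}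
    (ha : MemLp a 2 ν) (F : Finset α) :
    ∑ i ∈ F, (∫ y, a y * q i y ∂ν) ^ 2 ≤ ∫ y, a y ^ 2 ∂ν := by
  have h := (orthonormal_toLp hq ho).sum_inner_products_le (s := F) (ha.toLp a)
  have h1 : ‖ha.toLp a‖ ^ 2 = ∫ y, a y ^ 2 ∂ν := by
    rw [← real_inner_self_eq_norm_sq, L2.inner_def]
    refine integral_congr_ae ?_
    filter_upwards [ha.coeFn_toLp] with x h1
    simp [h1, sq]
  have h2 : ∀ i, inner ℝ ((hq i).toLp (q i)) (ha.toLp a) = ∫ y, a y * q i y ∂ν := by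
    intro i
    rw [L2.inner_def]
    refine integral_congr_ae ?_
    filter_upwards [(hq i).coeFn_toLp, ha.coeFn_toLp] with x h1 h2
    simp [h1, h2]
  rw [h1] at h
  refine le_trans (le_of_eq (Finset.sum_congr rfl fun i _ => ?_)) h
  rw [h2, Real.norm_eq_abs, sq_abs]

/-- Cauchy–Schwarz in the index, then Bessel in each factor. For rank-one functions this controls
the `ℓ¹` norm of the coefficients, where Bessel for the products `q_i ⊗ p_i` alone would give only
`ℓ²`. -/
theorem sum_abs_integral_mul_mul_le {Y : Type*} [MeasurableSpace Y] {ρ : Measure Y}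
    {q : α → X → ℝ} {p : α → Y → ℝ} (hq : ∀ i, MemLp (q i) 2 ν) (hp : ∀ i, MemLp (p i) 2 ρ)
    (hoq : ∀ i j, ∫ y, q i y * q j y ∂ν = if i = j then 1 else 0)
    (hop : ∀ i j, ∫ y, p i y * p j y ∂ρ = if i = j then 1 else 0) {a : X → ℝ} {b : Y → ℝ}
    (ha : MemLp a 2 ν) (hb : MemLp b 2 ρ) (F : Finset α) :
    ∑ i ∈ F, |(∫ y, a y * q i y ∂ν) * ∫ z, b z * p i z ∂ρ| ≤
      √(∫ y, a y ^ 2 ∂ν) * √(∫ z, b z ^ 2 ∂ρ) := by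
  have h := Real.sum_mul_le_sqrt_mul_sqrt F (fun i => |∫ y, a y * q i y ∂ν|)
    (fun i => |∫ z, b z * p i z ∂ρ|)
  simp only [sq_abs] at h
  simp only [abs_mul]
  refine h.trans ?_
  gcongr
  · exact sum_sq_integral_mul_le hq hoq ha F
  · exact sum_sq_integral_mul_le hp hop hb F

end Bessel

/-! ### Duality for the sum of the singular values -/

theorem abs_integral_mul_le_eLpNorm {X : Type*} [MeasurableSpace X] {ν : Measure X}
    {f g : X → ℝ} (hf : MemLp f 2 ν) (hg : MemLp g 2 ν) :
    |∫ x, f x * g x ∂ν| ≤ (eLpNorm f 2 ν).toReal * (eLpNorm g 2 ν).toReal := by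
  have h := norm_inner_le_norm (𝕜 := ℝ) (hg.toLp g) (hf.toLp f)
  rw [L2.inner_def, Lp.norm_toLp, Lp.norm_toLp, mul_comm] at h
  refine le_trans (le_of_eq ?_) h
  rw [Real.norm_eq_abs]
  congr 1
  refine integral_congr_ae ?_
  filter_upwards [hf.coeFn_toLp, hg.coeFn_toLp] with x h1 h2
  simp [h1, h2]

namespace FTTOrthogonalization

variable {d : ℕ} {μ : Fin d → Measure ℝ} [∀ i, IsFiniteMeasure (μ i)] {k : ℕ}
  {v w : (Fin d → ℝ) → ℝ}

/-- The function `q_α(x_{≤ k}) p_α(x_{> k})`. -/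
def term (O : FTTOrthogonalization μ v k) (α : RankIdx O.rank) (x : Fin d → ℝ) : ℝ :=
  O.q α (leftVars k x) * O.p α (rightVars k x)

theorem memLp_term (O : FTTOrthogonalization μ v k) (α : RankIdx O.rank) :
    MemLp (O.term α) 2 (prodMeasure μ) :=
  memLp_left_mul_right (O.memLp_q α) (O.memLp_p α)

theorem integral_left_mul_right_mul_term (O : FTTOrthogonalization μ v k) (α : RankIdx O.rank)
    {a : (LeftIdx d k → ℝ) → ℝ} {b : (RightIdx d k → ℝ) → ℝ}
    (ha : AEStronglyMeasurable a (leftMeasure μ k))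
    (hb : AEStronglyMeasurable b (rightMeasure μ k)) :
    ∫ x, a (leftVars k x) * b (rightVars k x) * O.term α x ∂(prodMeasure μ) =
      (∫ y, a y * O.q α y ∂(leftMeasure μ k)) * ∫ z, b z * O.p α z ∂(rightMeasure μ k) := by
  rw [← integral_left_mul_right (fun y => a y * O.q α y) (fun z => b z * O.p α z)
    (ha.mul (O.memLp_q α).1) (hb.mul (O.memLp_p α).1)]
  congr 1
  ext x
  simp only [term]
  ring

/-- Convergence in `L²` implies weak convergence: the error of a partial sum is at most its `L²`
distance from `v` times the norm of `g`. -/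
theorem hasSum_integral_mul (O : FTTOrthogonalization μ v k) {g : (Fin d → ℝ) → ℝ}
    (hg : MemLp g 2 (prodMeasure μ)) :
    HasSum (fun α => O.σ α * ∫ x, O.term α x * g x ∂(prodMeasure μ))
      (∫ x, v x * g x ∂(prodMeasure μ)) := by
  have hs : ∀ s : Finset (RankIdx O.rank), MemLp (fun x => ∑ α ∈ s, O.σ α * O.term α x) 2
      (prodMeasure μ) := fun s =>
    memLp_finsetSum s fun α _ => (O.memLp_term α).const_mul (O.σ α)
  have hi : ∀ α, Integrable (fun x => O.term α x * g x) (prodMeasure μ) := fun α =>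
    (O.memLp_term α).integrable_mul hg
  have hz := ENNReal.tendsto_toReal ENNReal.zero_ne_top |>.comp O.expansion
  have hz' := hz.mul_const (eLpNorm g 2 (prodMeasure μ)).toReal
  rw [ENNReal.toReal_zero, zero_mul] at hz'
  rw [HasSum, SummationFilter.unconditional_filter, tendsto_iff_norm_sub_tendsto_zero]
  refine squeeze_zero (fun _ => norm_nonneg _) (fun s => ?_) hz'
  have e : (∑ α ∈ s, O.σ α * ∫ x, O.term α x * g x ∂(prodMeasure μ)) -
      ∫ x, v x * g x ∂(prodMeasure μ) =
      -∫ x, (v x - ∑ α ∈ s, O.σ α * O.term α x) * g x ∂(prodMeasure μ) := by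
    have e1 : ∀ x, (v x - ∑ α ∈ s, O.σ α * O.term α x) * g x =
        v x * g x - ∑ α ∈ s, O.σ α * (O.term α x * g x) := by
      intro x
      rw [sub_mul, Finset.sum_mul]
      simp only [mul_assoc]
    simp only [e1]
    have hvg : Integrable (fun x => v x * g x) (prodMeasure μ) := O.memLp_v.integrable_mul hg
    rw [integral_sub hvg
      (integrable_finsetSum _ fun α _ => (hi α).const_mul _),
      integral_finsetSum _ fun α _ => (hi α).const_mul _]
    simp only [integral_const_mul]
    ring
  rw [e, norm_neg, Real.norm_eq_abs]
  refine (abs_integral_mul_le_eLpNorm (O.memLp_v.sub (hs s)) hg).trans (le_of_eq ?_)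
  simp only [Function.comp]
  congr 3
  ext x
  simp only [Pi.sub_apply, term]
  congr 1
  exact Finset.sum_congr rfl fun α _ => by ring

theorem integral_term_mul_term (O : FTTOrthogonalization μ v k) (α β : RankIdx O.rank) :
    ∫ x, O.term α x * O.term β x ∂(prodMeasure μ) = if α = β then 1 else 0 := by
  have h := O.integral_left_mul_right_mul_term β (O.memLp_q α).1 (O.memLp_p α).1
  rw [O.orthonormal_q, O.orthonormal_p] at h
  refine h.trans ?_
  split_ifs <;> simp

theorem integral_mul_term (O : FTTOrthogonalization μ v k) (α : RankIdx O.rank) :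
    ∫ x, v x * O.term α x ∂(prodMeasure μ) = O.σ α := by
  refine (O.hasSum_integral_mul (O.memLp_term α)).unique ?_
  simp only [integral_term_mul_term]
  convert hasSum_ite_eq α (O.σ α) using 2 with β
  split_ifs with h <;> simp [h]

theorem sum_abs_integral_term_mul_term_le (O : FTTOrthogonalization μ v k)
    (O' : FTTOrthogonalization μ w k) (β : RankIdx O'.rank) (F : Finset (RankIdx O.rank)) :
    ∑ α ∈ F, |∫ x, O'.term β x * O.term α x ∂(prodMeasure μ)| ≤ 1 := by
  have h := sum_abs_integral_mul_mul_le O.memLp_q O.memLp_p O.orthonormal_q O.orthonormal_p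
    (O'.memLp_q β) (O'.memLp_p β) F
  have e : ∀ α, ∫ x, O'.term β x * O.term α x ∂(prodMeasure μ) = _ := fun α =>
    O.integral_left_mul_right_mul_term α (O'.memLp_q β).1 (O'.memLp_p β).1
  simp only [e]
  refine h.trans (le_of_eq ?_)
  have h1 := O'.orthonormal_q β β
  have h2 := O'.orthonormal_p β β
  simp only [← sq, if_true] at h1 h2
  rw [h1, h2]
  simp

/-- The duality inequality. Expanding `w` along `O'`, the coefficient of each `O'.σ β` is the
pairing of a unit rank-one function with a partial isometry, hence at most `1`. Values in `ℝ≥0∞`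
allow a divergent right-hand side, so that the infimum over `O'` can be taken afterwards. -/
theorem sum_integral_mul_term_le (O : FTTOrthogonalization μ v k)
    (O' : FTTOrthogonalization μ w k) (F : Finset (RankIdx O.rank)) :
    ENNReal.ofReal (∑ α ∈ F, ∫ x, w x * O.term α x ∂(prodMeasure μ)) ≤
      ∑' β, ENNReal.ofReal (O'.σ β) := by
  have h : HasSum (fun β => ∑ α ∈ F, O'.σ β * ∫ x, O'.term β x * O.term α x ∂(prodMeasure μ))
      (∑ α ∈ F, ∫ x, w x * O.term α x ∂(prodMeasure μ)) :=
    hasSum_sum fun α _ => O'.hasSum_integral_mul (O.memLp_term α)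
  have hle : ∀ β, ∑ α ∈ F, O'.σ β * ∫ x, O'.term β x * O.term α x ∂(prodMeasure μ) ≤ O'.σ β := by
    intro β
    rw [← Finset.mul_sum]
    refine mul_le_of_le_one_right (O'.σ_pos β).le ?_
    exact (Finset.sum_le_sum fun α _ => le_abs_self _).trans
      (O.sum_abs_integral_term_mul_term_le O' β F)
  refine le_of_tendsto (ENNReal.tendsto_ofReal h) (Eventually.of_forall fun s => ?_)
  calc ENNReal.ofReal (∑ β ∈ s, ∑ α ∈ F,
        O'.σ β * ∫ x, O'.term β x * O.term α x ∂(prodMeasure μ))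
      ≤ ENNReal.ofReal (∑ β ∈ s, O'.σ β) :=
        ENNReal.ofReal_le_ofReal (Finset.sum_le_sum fun β _ => hle β)
    _ = ∑ β ∈ s, ENNReal.ofReal (O'.σ β) :=
        ENNReal.ofReal_sum_of_nonneg fun β _ => (O'.σ_pos β).le
    _ ≤ _ := ENNReal.sum_le_tsum s

theorem sum_integral_mul_term_le_singularSum (O : FTTOrthogonalization μ v k)
    (hw : singularSum μ k w ≠ ⊤) (F : Finset (RankIdx O.rank)) :
    ∑ α ∈ F, ∫ x, w x * O.term α x ∂(prodMeasure μ) ≤ (singularSum μ k w).toReal := by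
  refine (ENNReal.ofReal_le_iff_le_toReal hw).1 ?_
  exact le_iInf fun O' => O.sum_integral_mul_term_le O' F

theorem sum_σ_le_singularSum (O : FTTOrthogonalization μ v k)
    (hv : singularSum μ k v ≠ ⊤) (F : Finset (RankIdx O.rank)) :
    ∑ α ∈ F, O.σ α ≤ (singularSum μ k v).toReal := by
  have h := O.sum_integral_mul_term_le_singularSum hv F
  simpa only [integral_mul_term] using h

theorem summable_σ (O : FTTOrthogonalization μ v k) (hv : singularSum μ k v ≠ ⊤) :
    Summable O.σ :=
  summable_of_sum_le (fun α => (O.σ_pos α).le) fun F => O.sum_σ_le_singularSum hv F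

/-- Duality with `w = v` shows that no other orthogonalization has a smaller sum, so the infimum is
attained at every `O`. -/
theorem singularSum_toReal (O : FTTOrthogonalization μ v k) (hv : singularSum μ k v ≠ ⊤) :
    (singularSum μ k v).toReal = ∑' α, O.σ α := by
  refine le_antisymm ?_ ((O.summable_σ hv).tsum_le_of_sum_le fun F => O.sum_σ_le_singularSum hv F)
  refine ENNReal.toReal_le_of_le_ofReal (tsum_nonneg fun α => (O.σ_pos α).le) ?_
  rw [ENNReal.ofReal_tsum_of_nonneg (fun α => (O.σ_pos α).le) (O.summable_σ hv)]
  exact iInf_le _ O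

end FTTOrthogonalization

/-! ### The kernel of the fundamental theorem of calculus -/

/-- The kernel `K` with `g y - g c = ∫ K(y, s) g'(s) ds`. -/
noncomputable def ftcKernel (c y s : ℝ) : ℝ :=
  if c < s ∧ s ≤ y then 1 else if y < s ∧ s ≤ c then -1 else 0

theorem measurable_ftcKernel (c : ℝ) : Measurable fun p : ℝ × ℝ => ftcKernel c p.1 p.2 := by
  unfold ftcKernel
  refine Measurable.ite ?_ measurable_const (Measurable.ite ?_ measurable_const measurable_const)
  · exact (measurableSet_lt measurable_const measurable_snd).inter
      (measurableSet_le measurable_snd measurable_fst)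
  · exact (measurableSet_lt measurable_fst measurable_snd).inter
      (measurableSet_le measurable_snd measurable_const)

theorem abs_ftcKernel_le_one (c y s : ℝ) : |ftcKernel c y s| ≤ 1 := by
  unfold ftcKernel
  split_ifs <;> simp

/-- The segment from `c` to `y` stays in the interval `Ω`, so only values of `g'` on `Ω`, where
growth bounds are available, enter. -/
theorem eq_add_integral_ftcKernel {Ω : Set ℝ} (hΩ : Ω.OrdConnected) {c y : ℝ} (hc : c ∈ Ω)
    (hy : y ∈ Ω) {g g' : ℝ → ℝ} (hg : ∀ s, HasDerivAt g (g' s) s) (hg' : Continuous g') :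
    g y = g c + ∫ s in Ω, ftcKernel c y s * g' s := by
  have h1 := intervalIntegral.integral_eq_sub_of_hasDerivAt (a := c) (b := y)
    (fun s _ => hg s) (hg'.intervalIntegrable _ _)
  have h2 : ∫ s in Ω, ftcKernel c y s * g' s = ∫ s in c..y, g' s := by
    rcases le_total c y with h | h
    · rw [intervalIntegral.integral_of_le h, ← integral_indicator measurableSet_Ioc,
        ← integral_indicator hΩ.measurableSet]
      congr 1
      ext s
      by_cases hs : s ∈ Set.Ioc c y
      · have : s ∈ Ω := hΩ.out hc hy ⟨hs.1.le, hs.2⟩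
        have h3 : c < s ∧ s ≤ y := hs
        simp [this, ftcKernel, h3]
      · have h3 : ¬ (c < s ∧ s ≤ y) := hs
        have h4 : ¬ (y < s ∧ s ≤ c) := fun h5 => by linarith [h5.1, h5.2]
        simp [ftcKernel, h3, h4]
    · rw [intervalIntegral.integral_of_ge h, ← integral_neg,
        ← integral_indicator measurableSet_Ioc, ← integral_indicator hΩ.measurableSet]
      congr 1
      ext s
      by_cases hs : s ∈ Set.Ioc y c
      · have : s ∈ Ω := hΩ.out hy hc ⟨hs.1.le, hs.2⟩
        have h3 : y < s ∧ s ≤ c := hs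
        have h4 : ¬ (c < s ∧ s ≤ y) := fun h5 => by linarith [h5.1, h3.2]
        simp [this, ftcKernel, h3, h4]
      · have h3 : ¬ (y < s ∧ s ≤ c) := hs
        have h4 : ¬ (c < s ∧ s ≤ y) := fun h5 => by linarith [h5.1, h5.2]
        simp [ftcKernel, h3, h4]
  rw [h2, h1]
  ring

/-- The kernel vanishes unless `|s| ≤ |c| + |y|`, so powers of `s` can be traded for powers of `y`,
which have finite moments. The two extra powers buy the integrable factor `(1 + s²)⁻¹`. -/
theorem abs_ftcKernel_mul_le (c y s : ℝ) (M : ℕ) :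
    |ftcKernel c y s| * (1 + |s|) ^ M ≤
      ((1 + |c|) * (1 + |y|)) ^ (M + 2) * (1 + s ^ 2)⁻¹ := by
  rw [← div_eq_mul_inv, le_div_iff₀ (by positivity)]
  by_cases h : ftcKernel c y s = 0
  · rw [h]
    simp only [abs_zero, zero_mul]
    positivity
  have hs : |s| ≤ |c| + |y| := by
    unfold ftcKernel at h
    have : (c < s ∧ s ≤ y) ∨ (y < s ∧ s ≤ c) := by
      by_contra h'
      rw [not_or] at h'
      simp [h'.1, h'.2] at h
    refine abs_le.2 ⟨?_, ?_⟩ <;> rcases this with h | h <;>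
      linarith [neg_abs_le c, neg_abs_le y, le_abs_self c, le_abs_self y, abs_nonneg c,
        abs_nonneg y, h.1, h.2]
  have h1 : 1 + |s| ≤ (1 + |c|) * (1 + |y|) := by
    nlinarith [mul_nonneg (abs_nonneg c) (abs_nonneg y)]
  have h2 : 1 + s ^ 2 ≤ (1 + |s|) ^ 2 := by
    rw [← sq_abs s]
    nlinarith [abs_nonneg s]
  calc |ftcKernel c y s| * (1 + |s|) ^ M * (1 + s ^ 2)
      ≤ 1 * (1 + |s|) ^ M * (1 + |s|) ^ 2 := by
        gcongr
        exact abs_ftcKernel_le_one c y s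
    _ = (1 + |s|) ^ (M + 2) := by ring
    _ ≤ _ := by gcongr

/-! ### Moments -/

theorem integrable_one_add_abs_pow {ν : Measure ℝ} [IsFiniteMeasure ν]
    (hν : ∀ n : ℕ, Integrable (fun t : ℝ => |t| ^ n) ν) (n : ℕ) :
    Integrable (fun t : ℝ => (1 + |t|) ^ n) ν := by
  refine Integrable.mono' (((integrable_const (1 : ℝ)).add (hν n)).const_mul (2 ^ (n - 1)))
    (by fun_prop) (Eventually.of_forall fun t => ?_)
  rw [Real.norm_eq_abs, abs_of_nonneg (by positivity)]
  simpa using add_pow_le zero_le_one (abs_nonneg t) n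

theorem memLp_prod_one_add_abs_pow {ι : Type*} [Fintype ι] {ν : ι → Measure ℝ}
    [∀ i, IsFiniteMeasure (ν i)] (hν : ∀ i (n : ℕ), Integrable (fun t : ℝ => |t| ^ n) (ν i))
    (n : ℕ) : MemLp (fun x : ι → ℝ => ∏ j, (1 + |x j|) ^ n) 2 (Measure.pi ν) := by
  rw [memLp_two_iff_integrable_sq (Continuous.aestronglyMeasurable (by fun_prop))]
  simp only [← Finset.prod_pow, ← pow_mul]
  exact Integrable.fintype_prod_dep (f := fun _ t => (1 + |t|) ^ (n * 2))
    fun i => integrable_one_add_abs_pow (hν i) _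

/-- The constant in `sqrt_integral_ftcKernel_sq_mul_le`. -/
noncomputable def ftcKernelBound (ν : Measure ℝ) (c : ℝ) (M : ℕ) : ℝ :=
  √(∫ y, ((1 + |c|) * (1 + |y|)) ^ ((M + 2) * 2) ∂ν)

theorem sqrt_integral_ftcKernel_sq_mul_le {ν : Measure ℝ} [IsFiniteMeasure ν]
    (hν : ∀ n : ℕ, Integrable (fun t : ℝ => |t| ^ n) ν) (c s : ℝ) (M : ℕ) :
    √(∫ y, ftcKernel c y s ^ 2 ∂ν) * (1 + |s|) ^ M ≤ ftcKernelBound ν c M * (1 + s ^ 2)⁻¹ := by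
  rw [← div_eq_mul_inv, le_div_iff₀ (by positivity), mul_assoc, ftcKernelBound]
  refine Real.le_sqrt_of_sq_le ?_
  rw [mul_pow, Real.sq_sqrt (integral_nonneg fun y => sq_nonneg _), ← integral_mul_const]
  refine integral_mono_of_nonneg (Eventually.of_forall fun y => by positivity) ?_
    (Eventually.of_forall fun y => ?_)
  · simp only [mul_pow (1 + |c|)]
    exact (integrable_one_add_abs_pow hν _).const_mul _
  · have h := abs_ftcKernel_mul_le c y s M
    rw [← div_eq_mul_inv, le_div_iff₀ (by positivity)] at h
    simp only
    rw [← sq_abs (ftcKernel c y s), ← mul_pow, pow_mul, ← mul_assoc]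
    gcongr

/-! ### A bound on the nuclear norm of smooth functions -/

/-- The derivatives of `f` up to order `n` are bounded on `∏ Ω_i` by a product weight. -/
structure DerivBound {d : ℕ} (Ω : Fin d → Set ℝ) (K : ℝ) (M n : ℕ) (f : (Fin d → ℝ) → ℝ) :
    Prop where
  contDiff : ContDiff ℝ ∞ f
  bound : ∀ m ≤ n, ∀ x ∈ Set.univ.pi Ω, ‖iteratedFDeriv ℝ m f x‖ ≤ K * ∏ j, (1 + |x j|) ^ M

theorem norm_iteratedFDeriv_fderiv_single_le {d : ℕ} {f : (Fin d → ℝ) → ℝ}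
    (hf : ContDiff ℝ ∞ f) (i : Fin d) (m : ℕ) (x : Fin d → ℝ) :
    ‖iteratedFDeriv ℝ m (fun y => fderiv ℝ f y (Pi.single i 1)) x‖ ≤
      ‖iteratedFDeriv ℝ (m + 1) f x‖ := by
  have h := norm_iteratedFDeriv_clm_apply_const (𝕜 := ℝ) (f := fderiv ℝ f) (x := x)
    (N := ∞) (n := m) (c := Pi.single i (1 : ℝ))
    (hf.fderiv_right (m := ∞) (by simp)).contDiffAt (by exact_mod_cast le_top)
  simpa [norm_iteratedFDeriv_fderiv, Pi.norm_single] using h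

theorem contDiff_fderiv_single {d : ℕ} {f : (Fin d → ℝ) → ℝ}
    (hf : ContDiff ℝ ∞ f) (i : Fin d) :
    ContDiff ℝ ∞ fun y => fderiv ℝ f y (Pi.single i 1) :=
  (hf.fderiv_right (m := ∞) (by simp)).clm_apply contDiff_const

namespace DerivBound

variable {d : ℕ} {Ω : Fin d → Set ℝ} {K : ℝ} {M n : ℕ} {f : (Fin d → ℝ) → ℝ}

theorem mono (h : DerivBound Ω K M n f) {n' : ℕ} (hn : n' ≤ n) : DerivBound Ω K M n' f :=
  ⟨h.contDiff, fun m hm => h.bound m (hm.trans hn)⟩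

theorem fderiv_single (h : DerivBound Ω K M (n + 1) f) (i : Fin d) :
    DerivBound Ω K M n fun y => fderiv ℝ f y (Pi.single i 1) :=
  ⟨contDiff_fderiv_single h.contDiff i, fun m hm x hx =>
    (norm_iteratedFDeriv_fderiv_single_le h.contDiff i m x).trans
      (h.bound (m + 1) (by omega) x hx)⟩

theorem abs_le (h : DerivBound Ω K M n f) {x : Fin d → ℝ} (hx : x ∈ Set.univ.pi Ω) :
    |f x| ≤ K * ∏ j, (1 + |x j|) ^ M := by
  simpa using h.bound 0 (Nat.zero_le _) x hx

theorem eq_add_integral (h : DerivBound Ω K M n f) (hΩ : ∀ i, (Ω i).OrdConnected) (i : Fin d)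
    {c : ℝ} (hc : c ∈ Ω i) (y : Fin d → ℝ) {r : ℝ} (hr : r ∈ Ω i) :
    f (Function.update y i r) = f (Function.update y i c) +
      ∫ s in Ω i, ftcKernel c r s * fderiv ℝ f (Function.update y i s) (Pi.single i 1) := by
  refine eq_add_integral_ftcKernel (hΩ i) hc hr (g := fun s => f (Function.update y i s)) ?_ ?_
  · intro s
    have h1 := (h.contDiff.differentiable (by simp) (Function.update y i s)).hasFDerivAt
    exact h1.comp_hasDerivAt s (hasDerivAt_update y i s)
  · exact (contDiff_fderiv_single h.contDiff i).continuous.comp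
      (continuous_const.update i continuous_id)

end DerivBound

/-- The coordinates `x_1, …, x_k`. -/
def leftSet (d k : ℕ) : Finset (Fin d) := Finset.univ.filter fun j => (j : ℕ) < k

/-- The coordinates `x_{k+1}, …, x_d`. -/
def rightSet (d k : ℕ) : Finset (Fin d) := Finset.univ.filter fun j => k ≤ (j : ℕ)

section NuclearBound

variable {d : ℕ} {μ : Fin d → Measure ℝ} [∀ i, IsFiniteMeasure (μ i)] {k : ℕ}
  {v : (Fin d → ℝ) → ℝ} {Ω : Fin d → Set ℝ}

theorem ae_mem_pi {ι : Type*} [Fintype ι] {ν : ι → Measure ℝ} [∀ i, IsFiniteMeasure (ν i)]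
    {Ω : ι → Set ℝ} (hνΩ : ∀ i, ν i (Ω i)ᶜ = 0) :
    ∀ᵐ x ∂(Measure.pi ν), x ∈ Set.univ.pi Ω := by
  have : ∀ i, ∀ᵐ x ∂(Measure.pi ν), x i ∈ Ω i := fun i =>
    Measure.tendsto_eval_ae_ae.eventually (mem_ae_iff.2 (hνΩ i))
  filter_upwards [eventually_all.2 this] with x hx i _ using hx i

/-- The weight of the variables `x_{> k}` in the bound on the nuclear norm. -/
noncomputable def rightWeight (μ : Fin d → Measure ℝ) (k M : ℕ) : ℝ :=
  √(∫ z, (∏ j, (1 + |z j|) ^ M) ^ 2 ∂(rightMeasure μ k))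

/-- The factor of a variable in the bound on the nuclear norm. -/
noncomputable def coordWeight (ν : Measure ℝ) (c : ℝ) (M : ℕ) : ℝ :=
  √(ν.real Set.univ) * (1 + |c|) ^ M + ftcKernelBound ν c M * ∫ s : ℝ, (1 + s ^ 2)⁻¹

/-- With the left variables of `f` frozen at `t`, the function paired with the terms is a product
`a(x_{≤ k}) b(x_{> k})`, and the rank-one estimate applies. -/
theorem sum_abs_integral_rankOne_le (hμΩ : ∀ i, μ i (Ω i)ᶜ = 0)
    (hμ : ∀ i (n : ℕ), Integrable (fun t : ℝ => |t| ^ n) (μ i))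
    (O : FTTOrthogonalization μ v k) (F : Finset (RankIdx O.rank)) {K : ℝ} (hK : 0 ≤ K) {M n : ℕ}
    {f : (Fin d → ℝ) → ℝ} (hf : DerivBound Ω K M n f) {h : Fin d → ℝ → ℝ}
    (hm : ∀ j, Measurable (h j)) (h1 : ∀ j s, |h j s| ≤ 1) {t : Fin d → ℝ}
    (ht : t ∈ Set.univ.pi Ω) :
    ∑ α ∈ F, |∫ x, (∏ j ∈ leftSet d k, h j (x j)) * f ((rightSet d k).piecewise x t) *
        O.term α x ∂(prodMeasure μ)| ≤
      K * (∏ j ∈ leftSet d k, √(∫ s, h j s ^ 2 ∂(μ j)) * (1 + |t j|) ^ M) *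
        rightWeight μ k M := by
  set a : (LeftIdx d k → ℝ) → ℝ := fun y => ∏ j, h j.1 (y j) with ha
  set b : (RightIdx d k → ℝ) → ℝ := fun z =>
    f (fun j => if hj : k ≤ (j : ℕ) then z ⟨j, hj⟩ else t j) with hb
  have hprod : ∀ g : Fin d → ℝ, ∏ j ∈ leftSet d k, g j = ∏ j : LeftIdx d k, g j.1 := fun g =>
    Finset.prod_subtype _ (by simp [leftSet]) g
  have hprod' : ∀ g : Fin d → ℝ, ∏ j ∈ rightSet d k, g j = ∏ j : RightIdx d k, g j.1 := fun g =>
    Finset.prod_subtype _ (by simp [rightSet]) g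
  have hsplit : ∀ g : Fin d → ℝ, ∏ j, g j =
      (∏ j : LeftIdx d k, g j.1) * ∏ j : RightIdx d k, g j.1 := by
    intro g
    rw [← hprod, ← hprod', leftSet, rightSet, ← Finset.prod_filter_mul_prod_filter_not
      Finset.univ (fun j : Fin d => (j : ℕ) < k)]
    simp
  have e : ∀ x, (∏ j ∈ leftSet d k, h j (x j)) * f ((rightSet d k).piecewise x t) =
      a (leftVars k x) * b (rightVars k x) := by
    intro x
    rw [hprod]
    simp only [ha, hb, leftVars, rightVars]
    congr 2
    ext j
    by_cases hj : k ≤ (j : ℕ) <;> simp [Finset.piecewise, rightSet, hj]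
  have ham : Measurable a := Finset.measurable_prod _ fun j _ =>
    (hm j.1).comp (measurable_pi_apply j)
  have hbm : Continuous b := hf.contDiff.continuous.comp (continuous_pi fun j => by
    by_cases hj : k ≤ (j : ℕ)
    · simp only [hj, dif_pos]; exact continuous_apply _
    · simp only [hj, dif_neg, not_false_eq_true]; exact continuous_const)
  have ha2 : MemLp a 2 (leftMeasure μ k) := by
    refine MemLp.of_bound ham.aestronglyMeasurable 1 (Eventually.of_forall fun y => ?_)
    rw [Real.norm_eq_abs, ha, Finset.abs_prod]
    exact Finset.prod_le_one (fun j _ => abs_nonneg _) fun j _ => h1 _ _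
  have hbb : ∀ᵐ z ∂(rightMeasure μ k), |b z| ≤
      (K * ∏ j ∈ leftSet d k, (1 + |t j|) ^ M) * ∏ j, (1 + |z j|) ^ M := by
    filter_upwards [ae_mem_pi (ν := fun j : RightIdx d k => μ j.1) (Ω := fun j => Ω j.1)
      fun j => hμΩ j.1] with z hz
    refine (hf.abs_le ?_).trans (le_of_eq ?_)
    · intro j _
      by_cases hj : k ≤ (j : ℕ)
      · simpa [hj] using hz ⟨j, hj⟩ trivial
      · simpa [hj] using ht j trivial
    · rw [hsplit, hprod, mul_assoc]
      congr 2
      · refine Finset.prod_congr rfl fun j _ => ?_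
        have := j.2
        simp [not_le.2 this]
      · refine Finset.prod_congr rfl fun j _ => ?_
        have := j.2
        simp [this]
  have hw := memLp_prod_one_add_abs_pow (ν := fun j : RightIdx d k => μ j.1)
    (fun j => hμ j.1) M
  have hb2 : MemLp b 2 (rightMeasure μ k) := by
    refine MemLp.mono' (hw.const_mul (K * ∏ j ∈ leftSet d k, (1 + |t j|) ^ M))
      hbm.aestronglyMeasurable ?_
    simpa using hbb
  have hmain := sum_abs_integral_mul_mul_le O.memLp_q O.memLp_p O.orthonormal_q O.orthonormal_p
    ha2 hb2 F
  have e2 : ∀ α, ∫ x, (∏ j ∈ leftSet d k, h j (x j)) * f ((rightSet d k).piecewise x t) *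
      O.term α x ∂(prodMeasure μ) = _ := fun α => by
    simp only [e]
    exact O.integral_left_mul_right_mul_term α ham.aestronglyMeasurable hbm.aestronglyMeasurable
  simp only [e2]
  refine hmain.trans ?_
  have e3 : √(∫ y, a y ^ 2 ∂(leftMeasure μ k)) = ∏ j ∈ leftSet d k, √(∫ s, h j s ^ 2 ∂(μ j)) := by
    have := integral_fintype_prod_eq_prod (𝕜 := ℝ) (fun (j : LeftIdx d k) s => h j.1 s ^ 2)
      (μ := fun j => μ j.1)
    simp only [ha, ← Finset.prod_pow]
    rw [leftMeasure, this, Real.sqrt_prod _ fun j _ => integral_nonneg fun s => sq_nonneg _]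
    exact (hprod fun j => √(∫ s, h j s ^ 2 ∂(μ j))).symm
  have e4 : √(∫ z, b z ^ 2 ∂(rightMeasure μ k)) ≤
      (K * ∏ j ∈ leftSet d k, (1 + |t j|) ^ M) * rightWeight μ k M := by
    have hc : 0 ≤ K * ∏ j ∈ leftSet d k, (1 + |t j|) ^ M :=
      mul_nonneg hK (Finset.prod_nonneg fun j _ => by positivity)
    rw [rightWeight, ← Real.sqrt_sq hc, ← Real.sqrt_mul (sq_nonneg _), ← integral_const_mul]
    refine Real.sqrt_le_sqrt (integral_mono_ae hb2.integrable_sq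
      (hw.integrable_sq.const_mul _) ?_)
    filter_upwards [hbb] with z hz
    rw [← sq_abs (b z), ← mul_pow]
    gcongr
  rw [e3]
  refine (mul_le_mul_of_nonneg_left e4
    (Finset.prod_nonneg fun j _ => Real.sqrt_nonneg _)).trans (le_of_eq ?_)
  rw [Finset.prod_mul_distrib]
  ring

end NuclearBound

/-! ### Integrability of partially frozen functions -/

section NuclearBound

variable {d : ℕ} {μ : Fin d → Measure ℝ} [∀ i, IsFiniteMeasure (μ i)] {k : ℕ}
  {v : (Fin d → ℝ) → ℝ} {Ω : Fin d → Set ℝ}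

theorem piecewise_mem_pi (U : Finset (Fin d)) {x t : Fin d → ℝ} (hx : x ∈ Set.univ.pi Ω)
    (ht : t ∈ Set.univ.pi Ω) : U.piecewise x t ∈ Set.univ.pi Ω := by
  intro j _
  by_cases hj : j ∈ U
  · simpa [hj] using hx j trivial
  · simpa [hj] using ht j trivial

theorem one_le_prod_one_add_abs_pow (x : Fin d → ℝ) (M : ℕ) :
    1 ≤ ∏ j, (1 + |x j|) ^ M :=
  Finset.one_le_prod fun j _ => one_le_pow₀ (by linarith [abs_nonneg (x j)])

theorem DerivBound.abs_piecewise_le {K : ℝ} (hK : 0 ≤ K) {M n : ℕ} {f : (Fin d → ℝ) → ℝ}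
    (hf : DerivBound Ω K M n f) (U : Finset (Fin d)) {x t : Fin d → ℝ}
    (hx : x ∈ Set.univ.pi Ω) (ht : t ∈ Set.univ.pi Ω) :
    |f (U.piecewise x t)| ≤ K * ((∏ j, (1 + |x j|) ^ M) * ∏ j, (1 + |t j|) ^ M) := by
  refine (hf.abs_le (piecewise_mem_pi U hx ht)).trans ?_
  rw [← Finset.prod_mul_distrib]
  gcongr with j _
  · have h1 : ∀ r : ℝ, 1 ≤ (1 + |r|) ^ M := fun r => one_le_pow₀ (by linarith [abs_nonneg r])
    by_cases hj : j ∈ U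
    · simp only [hj, Finset.piecewise_eq_of_mem]
      exact le_mul_of_one_le_right (by positivity) (h1 _)
    · simp only [hj, not_false_eq_true, Finset.piecewise_eq_of_notMem]
      exact le_mul_of_one_le_left (by positivity) (h1 _)

theorem prod_one_add_abs_update_le (t : Fin d → ℝ) (i : Fin d) (s : ℝ) (M : ℕ) :
    ∏ j, (1 + |Function.update t i s j|) ^ M ≤ (1 + |s|) ^ M * ∏ j, (1 + |t j|) ^ M := by
  rw [← Finset.mul_prod_erase Finset.univ _ (Finset.mem_univ i), Function.update_self,
    ← Finset.mul_prod_erase Finset.univ (fun j => (1 + |t j|) ^ M) (Finset.mem_univ i)]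
  gcongr
  rw [Finset.prod_congr rfl fun j hj => by rw [Function.update_of_ne (Finset.ne_of_mem_erase hj)]]
  exact le_mul_of_one_le_left (Finset.prod_nonneg fun j _ => by positivity)
    (one_le_pow₀ (by linarith [abs_nonneg (t i)]))

theorem piecewise_update_eq {ι : Type*} [DecidableEq ι] {U : Finset ι} {i : ι} (hi : i ∉ U)
    (x t : ι → ℝ) (s : ℝ) :
    U.piecewise x (Function.update t i s) = Function.update (U.piecewise x t) i s := by
  ext j
  by_cases hj : j = i
  · subst hj; simp [hi]
  · by_cases hU : j ∈ U <;> simp [hU, hj]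

theorem continuous_piecewise_update {ι : Type*} [DecidableEq ι] (U : Finset ι) (t : ι → ℝ)
    (i : ι) :
    Continuous fun p : (ι → ℝ) × ℝ => U.piecewise p.1 (Function.update t i p.2) := by
  refine continuous_pi fun j => ?_
  by_cases hU : j ∈ U
  · simp only [hU, Finset.piecewise_eq_of_mem]
    fun_prop
  · simp only [hU, not_false_eq_true, Finset.piecewise_eq_of_notMem]
    exact (continuous_apply j).comp
      ((continuous_const (y := t)).update i continuous_snd)

theorem abs_prod_le_one {ι : Type*} (U : Finset ι) {h : ι → ℝ → ℝ} (h1 : ∀ j s, |h j s| ≤ 1)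
    (x : ι → ℝ) : |∏ j ∈ U, h j (x j)| ≤ 1 := by
  rw [Finset.abs_prod]
  exact Finset.prod_le_one (fun j _ => abs_nonneg _) fun j _ => h1 _ _

theorem measurable_prod_apply {ι : Type*} (U : Finset ι) {h : ι → ℝ → ℝ}
    (hm : ∀ j, Measurable (h j)) : Measurable fun x : ι → ℝ => ∏ j ∈ U, h j (x j) :=
  Finset.measurable_prod _ fun j _ => (hm j).comp (measurable_pi_apply j)

theorem integrable_prod_mul_piecewise (hμΩ : ∀ i, μ i (Ω i)ᶜ = 0)
    (hμ : ∀ i (n : ℕ), Integrable (fun t : ℝ => |t| ^ n) (μ i)) {K : ℝ} (hK : 0 ≤ K) {M n : ℕ}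
    {f : (Fin d → ℝ) → ℝ} (hf : DerivBound Ω K M n f) (U V : Finset (Fin d)) {h : Fin d → ℝ → ℝ}
    (hm : ∀ j, Measurable (h j)) (h1 : ∀ j s, |h j s| ≤ 1) {t : Fin d → ℝ}
    (ht : t ∈ Set.univ.pi Ω) {τ : (Fin d → ℝ) → ℝ} (hτ : MemLp τ 2 (prodMeasure μ)) :
    Integrable (fun x => (∏ j ∈ V, h j (x j)) * f (U.piecewise x t) * τ x) (prodMeasure μ) := by
  refine MemLp.integrable_mul (MemLp.mono' ((memLp_prod_one_add_abs_pow hμ M).const_mul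
    (K * ∏ j, (1 + |t j|) ^ M)) ?_ ?_) hτ
  · have hc : Continuous fun x : Fin d → ℝ => U.piecewise x t := by
      rcases isEmpty_or_nonempty (Fin d) with hd | ⟨⟨i⟩⟩
      · exact continuous_of_const fun x y => by ext j; exact hd.elim j
      · have := (continuous_piecewise_update U t i).comp
          (continuous_id.prodMk (continuous_const (y := t i)))
        simpa [Function.comp_def] using this
    exact ((measurable_prod_apply V hm).mul
      (hf.contDiff.continuous.comp hc).measurable).aestronglyMeasurable
  · filter_upwards [ae_mem_pi hμΩ] with x hx
    rw [Real.norm_eq_abs, abs_mul]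
    calc |∏ j ∈ V, h j (x j)| * |f (U.piecewise x t)|
        ≤ 1 * (K * ((∏ j, (1 + |x j|) ^ M) * ∏ j, (1 + |t j|) ^ M)) := by
          gcongr
          · exact abs_prod_le_one V h1 x
          · exact hf.abs_piecewise_le hK U hx ht
      _ = _ := by ring

theorem integrable_ftcKernel_mul (hμΩ : ∀ i, μ i (Ω i)ᶜ = 0)
    (hΩ : ∀ i, (Ω i).OrdConnected)
    (hμ : ∀ i (n : ℕ), Integrable (fun t : ℝ => |t| ^ n) (μ i)) {K : ℝ} (hK : 0 ≤ K) {M n : ℕ}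
    {f : (Fin d → ℝ) → ℝ} (hf : DerivBound Ω K M n f) (U V : Finset (Fin d)) {h : Fin d → ℝ → ℝ}
    (hm : ∀ j, Measurable (h j)) (h1 : ∀ j s, |h j s| ≤ 1) {t : Fin d → ℝ}
    (ht : t ∈ Set.univ.pi Ω) {τ : (Fin d → ℝ) → ℝ} (hτ : MemLp τ 2 (prodMeasure μ)) (i : Fin d)
    (c : ℝ) :
    Integrable (fun p : (Fin d → ℝ) × ℝ => (∏ j ∈ V, h j (p.1 j)) * (ftcKernel c (p.1 i) p.2 *
      f (U.piecewise p.1 (Function.update t i p.2))) * τ p.1)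
      ((prodMeasure μ).prod (volume.restrict (Ω i))) := by
  -- The exponent `M` comes from the bound on `f`, and `M + 2` from the kernel estimate.
  have hw : Integrable (fun x => (∏ j, (1 + |x j|) ^ (M + (M + 2))) * |τ x|) (prodMeasure μ) :=
    (memLp_prod_one_add_abs_pow hμ (M + (M + 2))).integrable_mul hτ.abs
  have hb := ((hw.mul_prod (integrable_inv_one_add_sq.restrict (s := Ω i))).const_mul
    (K * (1 + |c|) ^ (M + 2) * ∏ j, (1 + |t j|) ^ M))
  refine hb.mono' ?_ ?_
  · refine AEStronglyMeasurable.mul (Measurable.aestronglyMeasurable ?_) hτ.1.comp_fst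
    refine ((measurable_prod_apply V hm).comp measurable_fst).mul (Measurable.mul ?_ ?_)
    · exact (measurable_ftcKernel c).comp (f := fun p : (Fin d → ℝ) × ℝ => (p.1 i, p.2))
        (((measurable_pi_apply i).comp measurable_fst).prodMk measurable_snd)
    · exact hf.contDiff.continuous.measurable.comp (continuous_piecewise_update U t i).measurable
  · have h2 : ∀ᵐ p ∂((prodMeasure μ).prod (volume.restrict (Ω i))), p.1 ∈ Set.univ.pi Ω :=
      Measure.quasiMeasurePreserving_fst.ae (ae_mem_pi hμΩ)
    have h3 : ∀ᵐ p ∂((prodMeasure μ).prod (volume.restrict (Ω i))), p.2 ∈ Ω i :=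
      Measure.quasiMeasurePreserving_snd.ae (ae_restrict_mem (hΩ i).measurableSet)
    filter_upwards [h2, h3] with ⟨x, s⟩ hx hs
    simp only at hx hs ⊢
    have ht' : Function.update t i s ∈ Set.univ.pi Ω := by
      intro j _
      by_cases hj : j = i
      · subst hj; simpa using hs
      · simpa [hj] using ht j trivial
    rw [Real.norm_eq_abs, abs_mul, abs_mul, abs_mul]
    have hxi : (1 + |x i|) ^ (M + 2) ≤ ∏ j, (1 + |x j|) ^ (M + 2) := by
      rw [← Finset.mul_prod_erase Finset.univ _ (Finset.mem_univ i)]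
      exact le_mul_of_one_le_right (by positivity)
        (Finset.one_le_prod fun j _ => one_le_pow₀ (by linarith [abs_nonneg (x j)]))
    have hT : 0 ≤ ∏ j, (1 + |t j|) ^ M := Finset.prod_nonneg fun j _ => by positivity
    have hX : 0 ≤ ∏ j, (1 + |x j|) ^ M := Finset.prod_nonneg fun j _ => by positivity
    calc |∏ j ∈ V, h j (x j)| * (|ftcKernel c (x i) s| *
          |f (U.piecewise x (Function.update t i s))|) * |τ x|
        ≤ 1 * (|ftcKernel c (x i) s| * (K * ((∏ j, (1 + |x j|) ^ M) *
            ((1 + |s|) ^ M * ∏ j, (1 + |t j|) ^ M)))) * |τ x| := by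
          gcongr
          · exact abs_prod_le_one V h1 x
          · refine (hf.abs_piecewise_le hK U hx ht').trans ?_
            gcongr
            exact prod_one_add_abs_update_le t i s M
      _ = (|ftcKernel c (x i) s| * (1 + |s|) ^ M) * (K * ((∏ j, (1 + |x j|) ^ M) *
            ∏ j, (1 + |t j|) ^ M)) * |τ x| := by ring
      _ ≤ (((1 + |c|) ^ (M + 2) * ∏ j, (1 + |x j|) ^ (M + 2)) * (1 + s ^ 2)⁻¹) *
            (K * ((∏ j, (1 + |x j|) ^ M) * ∏ j, (1 + |t j|) ^ M)) * |τ x| := by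
          refine mul_le_mul_of_nonneg_right (mul_le_mul_of_nonneg_right ?_ (by positivity))
            (abs_nonneg _)
          refine (abs_ftcKernel_mul_le c (x i) s M).trans ?_
          rw [mul_pow]
          gcongr
      _ = _ := by
          simp only [pow_add _ M (M + 2), Finset.prod_mul_distrib]
          ring

end NuclearBound

/-! ### Superposition of rank-one functions -/

section NuclearBound

variable {d : ℕ} {μ : Fin d → Measure ℝ} [∀ i, IsFiniteMeasure (μ i)] {k : ℕ}
  {v : (Fin d → ℝ) → ℝ} {Ω : Fin d → Set ℝ}

/-- The triangle inequality for a superposition: Fubini moves the parameter `s` outside, so a bound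
on the sum for each `s` suffices. -/
theorem sum_abs_integral_add_integral_le {X β : Type*} [MeasurableSpace X] {ν : Measure X}
    {ρ : Measure ℝ} [SFinite ν] [SFinite ρ] (F : Finset β) {w a : β → X → ℝ}
    {G : β → X × ℝ → ℝ} (ha : ∀ i, Integrable (a i) ν) (hG : ∀ i, Integrable (G i) (ν.prod ρ))
    (hw : ∀ i, ∀ᵐ x ∂ν, w i x = a i x + ∫ s, G i (x, s) ∂ρ) {B : ℝ → ℝ} (hB : Integrable B ρ)
    (h : ∀ᵐ s ∂ρ, ∑ i ∈ F, |∫ x, G i (x, s) ∂ν| ≤ B s) :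
    ∑ i ∈ F, |∫ x, w i x ∂ν| ≤ ∑ i ∈ F, |∫ x, a i x ∂ν| + ∫ s, B s ∂ρ := by
  have h1 : ∀ i, ∫ x, w i x ∂ν = ∫ x, a i x ∂ν + ∫ s, ∫ x, G i (x, s) ∂ν ∂ρ := by
    intro i
    rw [integral_congr_ae (hw i), integral_add (ha i) (hG i).integral_prod_left,
      integral_integral_swap (f := fun x s => G i (x, s)) (hG i)]
  have h2 : ∀ i, Integrable (fun s => |∫ x, G i (x, s) ∂ν|) ρ := fun i =>
    (hG i).integral_prod_right.abs
  calc ∑ i ∈ F, |∫ x, w i x ∂ν|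
      ≤ ∑ i ∈ F, (|∫ x, a i x ∂ν| + ∫ s, |∫ x, G i (x, s) ∂ν| ∂ρ) := by
        refine Finset.sum_le_sum fun i _ => ?_
        rw [h1 i]
        exact (abs_add_le _ _).trans (by gcongr; exact abs_integral_le_integral_abs)
    _ = ∑ i ∈ F, |∫ x, a i x ∂ν| + ∫ s, ∑ i ∈ F, |∫ x, G i (x, s) ∂ν| ∂ρ := by
        rw [Finset.sum_add_distrib, integral_finsetSum _ fun i _ => h2 i]
    _ ≤ _ := by
        refine add_le_add le_rfl ?_
        exact integral_mono_ae (integrable_finsetSum _ fun i _ => h2 i) hB h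

/-- `S` holds the left variables on which `f` still depends; the others are frozen at `t` and occur
only through the factors `h j`. Removing `i` from `S` splits `f` into its value at `x_i = c_i`, with
new factor `1`, and an integral over `s` of `∂_i f` at `x_i = s`, with new factor the kernel. Each
variable costs one derivative, whence the order `S.card`. The induction must leave `f`, `h` and `t`
free because all three change. -/
theorem sum_abs_integral_piecewise_le (hΩ : ∀ i, (Ω i).OrdConnected)
    (hμΩ : ∀ i, μ i (Ω i)ᶜ = 0)
    (hμ : ∀ i (n : ℕ), Integrable (fun t : ℝ => |t| ^ n) (μ i))
    (O : FTTOrthogonalization μ v k) (F : Finset (RankIdx O.rank)) {K : ℝ} (hK : 0 ≤ K) {M : ℕ}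
    {c : Fin d → ℝ} (hc : c ∈ Set.univ.pi Ω) (S : Finset (Fin d)) (hS : S ⊆ leftSet d k) :
    ∀ {f : (Fin d → ℝ) → ℝ}, DerivBound Ω K M S.card f → ∀ {h : Fin d → ℝ → ℝ},
      (∀ j, Measurable (h j)) → (∀ j s, |h j s| ≤ 1) → ∀ {t : Fin d → ℝ}, t ∈ Set.univ.pi Ω →
      ∑ α ∈ F, |∫ x, (∏ j ∈ leftSet d k \ S, h j (x j)) *
          f ((S ∪ rightSet d k).piecewise x t) * O.term α x ∂(prodMeasure μ)| ≤
        K * (∏ j ∈ leftSet d k \ S, √(∫ s, h j s ^ 2 ∂(μ j)) * (1 + |t j|) ^ M) *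
          ((∏ j ∈ S, coordWeight (μ j) (c j) M) * rightWeight μ k M) := by
  induction S using Finset.induction_on with
  | empty =>
    intro f hf h hm h1 t ht
    have e : ∀ x, (∅ ∪ rightSet d k).piecewise x t = (rightSet d k).piecewise x t := by
      intro x
      ext j
      simp [Finset.piecewise]
    simp only [e]
    simpa using sum_abs_integral_rankOne_le hμΩ hμ O F hK hf hm h1 ht
  | insert i S hi ih =>
    intro f hf h hm h1 t ht
    rw [Finset.card_insert_of_notMem hi] at hf
    have hiL : i ∈ leftSet d k := hS (Finset.mem_insert_self _ _)
    have ih := @ih ((Finset.subset_insert _ _).trans hS)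
    have hiR : i ∉ rightSet d k := by
      simp only [leftSet, rightSet, Finset.mem_filter, Finset.mem_univ, true_and] at hiL ⊢
      omega
    have hiU : i ∉ S ∪ rightSet d k := by simp [hi, hiR]
    set V := leftSet d k \ insert i S with hV
    have hiV : i ∉ V := by simp [hV]
    have hLS : leftSet d k \ S = insert i V := by
      ext j
      simp only [hV, Finset.mem_sdiff, Finset.mem_insert]
      by_cases hj : j = i
      · subst hj; simp [hiL, hi]
      · simp [hj]
    have hpw : ∀ x, (insert i S ∪ rightSet d k).piecewise x t =
        Function.update ((S ∪ rightSet d k).piecewise x t) i (x i) := by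
      intro x
      rw [Finset.insert_union, Finset.piecewise_insert]
    have hpi : ∀ s ∈ Ω i, Function.update t i s ∈ Set.univ.pi Ω := by
      intro s hs j _
      by_cases hj : j = i
      · subst hj; simpa using hs
      · simpa [hj] using ht j trivial
    -- The induction hypothesis with variable `i` frozen at `s` and carried by the factor `h'`; it
    -- serves both the boundary term and the integral term.
    have key : ∀ (h' : ℝ → ℝ) (s : ℝ), Measurable h' → (∀ r, |h' r| ≤ 1) → s ∈ Ω i →
        ∀ g, DerivBound Ω K M S.card g →
        ∑ α ∈ F, |∫ x, (∏ j ∈ V, h j (x j)) * (h' (x i) *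
          g ((S ∪ rightSet d k).piecewise x (Function.update t i s))) *
            O.term α x ∂(prodMeasure μ)| ≤
        (√(∫ r, h' r ^ 2 ∂(μ i)) * (1 + |s|) ^ M) *
          (K * (∏ j ∈ V, √(∫ s, h j s ^ 2 ∂(μ j)) * (1 + |t j|) ^ M) *
            ((∏ j ∈ S, coordWeight (μ j) (c j) M) * rightWeight μ k M)) := by
      intro h' s hm' h1' hs g hg
      have := ih hg (h := Function.update h i h')
        (fun j => by
          by_cases hj : j = i
          · subst hj; simpa using hm'
          · simpa [hj] using hm j)
        (fun j r => by
          by_cases hj : j = i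
          · subst hj; simpa using h1' r
          · simpa [hj] using h1 j r) (hpi s hs)
      rw [hLS] at this
      have e1 : ∀ x : Fin d → ℝ, ∏ j ∈ insert i V, Function.update h i h' j (x j) =
          (∏ j ∈ V, h j (x j)) * h' (x i) := by
        intro x
        rw [Finset.prod_insert hiV, Function.update_self, mul_comm]
        congr 1
        refine Finset.prod_congr rfl fun j hj => ?_
        rw [Function.update_of_ne (ne_of_mem_of_not_mem hj hiV)]
      have e2 : ∏ j ∈ insert i V, √(∫ r, Function.update h i h' j r ^ 2 ∂(μ j)) *
          (1 + |Function.update t i s j|) ^ M = (√(∫ r, h' r ^ 2 ∂(μ i)) * (1 + |s|) ^ M) *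
          (∏ j ∈ V, √(∫ s, h j s ^ 2 ∂(μ j)) * (1 + |t j|) ^ M) := by
        rw [Finset.prod_insert hiV, Function.update_self, Function.update_self]
        congr 1
        refine Finset.prod_congr rfl fun j hj => ?_
        rw [Function.update_of_ne (ne_of_mem_of_not_mem hj hiV),
          Function.update_of_ne (ne_of_mem_of_not_mem hj hiV)]
      rw [e2] at this
      simp only [e1] at this
      refine le_trans (le_of_eq ?_) (this.trans (le_of_eq ?_))
      · simp only [mul_assoc]
      · ring
    set f' : (Fin d → ℝ) → ℝ := fun y => fderiv ℝ f y (Pi.single i 1) with hf'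
    have hfd : DerivBound Ω K M S.card f' := hf.fderiv_single i
    set P := K * (∏ j ∈ V, √(∫ s, h j s ^ 2 ∂(μ j)) * (1 + |t j|) ^ M) *
            ((∏ j ∈ S, coordWeight (μ j) (c j) M) * rightWeight μ k M) with hP
    have hCW : ∀ j, 0 ≤ coordWeight (μ j) (c j) M := fun j => by
      have : 0 ≤ ∫ s : ℝ, (1 + s ^ 2)⁻¹ := integral_nonneg fun s => by positivity
      have := Real.sqrt_nonneg (∫ y, ((1 + |c j|) * (1 + |y|)) ^ ((M + 2) * 2) ∂(μ j))
      unfold coordWeight ftcKernelBound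
      positivity
    have hP0 : 0 ≤ P := by
      refine mul_nonneg (mul_nonneg hK (Finset.prod_nonneg fun j _ => by positivity))
        (mul_nonneg (Finset.prod_nonneg fun j _ => hCW j) (Real.sqrt_nonneg _))
    have hG : ∀ α, Integrable (fun p : (Fin d → ℝ) × ℝ => (∏ j ∈ V, h j (p.1 j)) *
        (ftcKernel (c i) (p.1 i) p.2 * f' ((S ∪ rightSet d k).piecewise p.1
          (Function.update t i p.2))) * O.term α p.1)
        ((prodMeasure μ).prod (volume.restrict (Ω i))) := fun α =>
      integrable_ftcKernel_mul hμΩ hΩ hμ hK hfd _ V hm h1 ht (O.memLp_term α) i (c i)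
    have ha : ∀ α, Integrable (fun x => (∏ j ∈ V, h j (x j)) *
        f ((S ∪ rightSet d k).piecewise x (Function.update t i (c i))) * O.term α x)
        (prodMeasure μ) := fun α =>
      integrable_prod_mul_piecewise hμΩ hμ hK hf _ V hm h1 (hpi _ (hc i trivial))
        (O.memLp_term α)
    have hB : Integrable (fun s : ℝ => ftcKernelBound (μ i) (c i) M * (1 + s ^ 2)⁻¹ * P)
        (volume.restrict (Ω i)) :=
      ((integrable_inv_one_add_sq.restrict (s := Ω i)).const_mul _).mul_const _
    have main := sum_abs_integral_add_integral_le F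
      (w := fun α x => (∏ j ∈ V, h j (x j)) *
          f ((insert i S ∪ rightSet d k).piecewise x t) * O.term α x) ha hG ?_ hB ?_
    · refine main.trans ?_
      -- `k0` and `k1` produce the two summands of `coordWeight`.
      have k0 := key (fun _ => 1) (c i) measurable_const (by simp) (hc i trivial) f
        (hf.mono (Nat.le_succ _))
      simp only [one_mul, one_pow, integral_const, smul_eq_mul, mul_one] at k0
      have k1 : ∫ s in Ω i, ftcKernelBound (μ i) (c i) M * (1 + s ^ 2)⁻¹ * P ≤
          ftcKernelBound (μ i) (c i) M * (∫ s : ℝ, (1 + s ^ 2)⁻¹) * P := by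
        rw [integral_mul_const, integral_const_mul]
        refine mul_le_mul_of_nonneg_right (mul_le_mul_of_nonneg_left ?_ (Real.sqrt_nonneg _)) hP0
        exact setIntegral_le_integral integrable_inv_one_add_sq
          (Eventually.of_forall fun s => by positivity)
      refine (add_le_add k0 k1).trans (le_of_eq ?_)
      rw [Finset.prod_insert hi, hP, coordWeight]
      ring
    · intro α
      filter_upwards [ae_mem_pi hμΩ] with x hx
      rw [hpw, hf.eq_add_integral hΩ i (hc i trivial) _ (hx i trivial)]
      simp only [piecewise_update_eq hiU]
      rw [integral_mul_const, integral_const_mul]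
      ring
    · filter_upwards [ae_restrict_mem (hΩ i).measurableSet] with s hs
      refine (key (fun r => ftcKernel (c i) r s) s
        ((measurable_ftcKernel (c i)).comp (measurable_id.prodMk measurable_const))
        (fun r => abs_ftcKernel_le_one _ _ _) hs f' hfd).trans ?_
      refine mul_le_mul_of_nonneg_right ?_ hP0
      exact sqrt_integral_ftcKernel_sq_mul_le (hμ i) (c i) s M

/-- The constant is chosen before `f` and `F`: this uniformity gives both summability over an
infinite rank and a common Taylor remainder. -/
theorem exists_sum_abs_integral_mul_term_le (hΩ : ∀ i, (Ω i).OrdConnected)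
    (hμΩ : ∀ i, μ i (Ω i)ᶜ = 0)
    (hμ : ∀ i (n : ℕ), Integrable (fun t : ℝ => |t| ^ n) (μ i))
    (O : FTTOrthogonalization μ v k) {K : ℝ} (hK : 0 ≤ K) (M : ℕ) :
    ∃ C, ∀ f, DerivBound Ω K M d f → ∀ F : Finset (RankIdx O.rank),
      ∑ α ∈ F, |∫ x, f x * O.term α x ∂(prodMeasure μ)| ≤ C := by
  rcases (Set.univ.pi Ω).eq_empty_or_nonempty with he | ⟨c, hc⟩
  · have h0 : prodMeasure μ = 0 := by
      rw [← ae_eq_bot, ← eventually_false_iff_eq_bot]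
      -- An empty domain offers no base point `c`, but then the measure vanishes.
      filter_upwards [ae_mem_pi hμΩ] with x hx
      simp [he] at hx
    exact ⟨0, fun f _ F => by simp [h0]⟩
  · refine ⟨K * ((∏ j ∈ leftSet d k, coordWeight (μ j) (c j) M) * rightWeight μ k M),
      fun f hf F => ?_⟩
    · have hcard : (leftSet d k).card ≤ d := by
        simpa using Finset.card_le_univ (leftSet d k)
      have h := sum_abs_integral_piecewise_le hΩ hμΩ hμ O F hK hc (leftSet d k) subset_rfl
        (hf.mono hcard) (h := fun _ _ => 1) (fun _ => measurable_const) (by simp) hc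
      have e : ∀ x, (leftSet d k ∪ rightSet d k).piecewise x c = x := by
        intro x
        ext j
        have : (j : ℕ) < k ∨ k ≤ (j : ℕ) := by omega
        simp [Finset.piecewise, leftSet, rightSet, this]
      simp only [e] at h
      simpa using h

end NuclearBound

/-! ### Families of functions with derivatives of polynomial growth -/

section Growth

variable {d : ℕ} {Ω : Fin d → Set ℝ}

/-- Passes from the growth hypothesis to weights that factor over the coordinates, as the splitting
of the variables requires. -/
theorem one_add_norm_pow_le (x : Fin d → ℝ) (M : ℕ) :
    (1 + ‖x‖) ^ M ≤ ∏ j, (1 + |x j|) ^ M := by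
  rw [Finset.prod_pow]
  refine pow_le_pow_left₀ (by positivity) ?_ M
  have h1 : (1 : ℝ) ≤ ∏ j, (1 + |x j|) := by
    simpa using one_le_prod_one_add_abs_pow x 1
  have h2 : ‖x‖ ≤ ∏ j, (1 + |x j|) - 1 := by
    refine (pi_norm_le_iff_of_nonneg (by linarith)).2 fun j => ?_
    rw [Real.norm_eq_abs, le_sub_iff_add_le, add_comm,
      ← Finset.mul_prod_erase Finset.univ _ (Finset.mem_univ j)]
    exact le_mul_of_one_le_right (by positivity)
      (Finset.one_le_prod fun j _ => by linarith [abs_nonneg (x j)])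
  linarith

namespace DerivBound

variable {K K' : ℝ} {M M' n : ℕ} {f g : (Fin d → ℝ) → ℝ}

theorem weaken (h : DerivBound Ω K M n f) (hK' : 0 ≤ K') (hK : K ≤ K') (hM : M ≤ M') :
    DerivBound Ω K' M' n f := by
  refine ⟨h.contDiff, fun m hm x hx => (h.bound m hm x hx).trans ?_⟩
  have h0 : ∀ j, 1 ≤ 1 + |x j| := fun j => by linarith [abs_nonneg (x j)]
  refine mul_le_mul hK (Finset.prod_le_prod (fun j _ => by positivity) fun j _ =>
    pow_le_pow_right₀ (h0 j) hM) (Finset.prod_nonneg fun j _ => by positivity) hK'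

theorem add (hf : DerivBound Ω K M n f) (hg : DerivBound Ω K' M n g) :
    DerivBound Ω (K + K') M n fun x => f x + g x := by
  refine ⟨hf.contDiff.add hg.contDiff, fun m hm x hx => ?_⟩
  have e : iteratedFDeriv ℝ m (fun x => f x + g x) x =
      iteratedFDeriv ℝ m f x + iteratedFDeriv ℝ m g x :=
    iteratedFDeriv_add_apply (hf.contDiff.of_le (by exact_mod_cast le_top)).contDiffAt
      (hg.contDiff.of_le (by exact_mod_cast le_top)).contDiffAt
  rw [e, add_mul]
  exact (norm_add_le _ _).trans (add_le_add (hf.bound m hm x hx) (hg.bound m hm x hx))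

theorem mul (hf : DerivBound Ω K M n f) (hg : DerivBound Ω K' M' n g) (hK : 0 ≤ K)
    (hK' : 0 ≤ K') : DerivBound Ω (2 ^ n * (K * K')) (M + M') n fun x => f x * g x := by
  refine ⟨hf.contDiff.mul hg.contDiff, fun m hm x hx => ?_⟩
  refine (norm_iteratedFDeriv_mul_le hf.contDiff hg.contDiff x
    (by exact_mod_cast le_top)).trans ?_
  calc ∑ i ∈ Finset.range (m + 1), (m.choose i : ℝ) * ‖iteratedFDeriv ℝ i f x‖ *
        ‖iteratedFDeriv ℝ (m - i) g x‖
      ≤ ∑ i ∈ Finset.range (m + 1), (m.choose i : ℝ) * (K * ∏ j, (1 + |x j|) ^ M) *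
        (K' * ∏ j, (1 + |x j|) ^ M') := by
        refine Finset.sum_le_sum fun i hi => ?_
        have hi' := Finset.mem_range.1 hi
        have := hf.bound i (by omega) x hx
        have := hg.bound (m - i) (by omega) x hx
        gcongr
    _ = 2 ^ m * (K * K') * ∏ j, (1 + |x j|) ^ (M + M') := by
        rw [← Finset.sum_mul, ← Finset.sum_mul, ← Nat.cast_sum, Nat.sum_range_choose]
        simp only [pow_add, Finset.prod_mul_distrib]
        push_cast
        ring
    _ ≤ _ := by
        have : 0 ≤ ∏ j, (1 + |x j|) ^ (M + M') := Finset.prod_nonneg fun j _ => by positivity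
        gcongr
        norm_num

theorem const (c : ℝ) (hc : |c| ≤ K) : DerivBound Ω K 0 n fun _ => c := by
  refine ⟨contDiff_const, fun m _ x _ => ?_⟩
  rcases m with _ | m
  · simpa using hc
  · rw [iteratedFDeriv_succ_const]
    simpa using (abs_nonneg c).trans hc

theorem coord (l : Fin d) : DerivBound Ω 1 1 n fun x => x l := by
  refine ⟨contDiff_apply ℝ ℝ l, fun m _ x _ => ?_⟩
  have h1 : 1 + |x l| ≤ ∏ j, (1 + |x j|) ^ 1 := by
    simp only [pow_one]
    rw [← Finset.mul_prod_erase Finset.univ _ (Finset.mem_univ l)]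
    exact le_mul_of_one_le_right (by positivity)
      (Finset.one_le_prod fun j _ => by linarith [abs_nonneg (x j)])
  rw [one_mul]
  have hfd : fderiv ℝ (fun x : Fin d → ℝ => x l) =
      fun _ => ContinuousLinearMap.proj (R := ℝ) (φ := fun _ : Fin d => ℝ) l := by
    ext1 y
    exact (ContinuousLinearMap.proj (R := ℝ) (φ := fun _ : Fin d => ℝ) l).fderiv
  rcases m with _ | m
  · simp only [norm_iteratedFDeriv_zero, Real.norm_eq_abs]
    linarith
  · rw [← norm_iteratedFDeriv_fderiv, hfd]
    rcases m with _ | m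
    · rw [norm_iteratedFDeriv_zero]
      refine le_trans ?_ ((le_add_of_nonneg_right (abs_nonneg (x l))).trans h1)
      refine ContinuousLinearMap.opNorm_le_bound _ zero_le_one fun y => ?_
      simpa using norm_le_pi_norm y l
    · rw [iteratedFDeriv_succ_const]
      simp only [Pi.zero_apply, norm_zero]
      linarith [abs_nonneg (x l)]

end DerivBound

/-- Near `0`, the functions `f ε` are smooth, with derivatives of uniform polynomial growth
on `∏ Ω_i`. -/
def UnifGrowth (Ω : Fin d → Set ℝ) (f : ℝ → (Fin d → ℝ) → ℝ) : Prop :=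
  ∀ n, ∃ (K : ℝ) (M : ℕ), 0 ≤ K ∧ ∀ᶠ ε in 𝓝 0, DerivBound Ω K M n (f ε)

namespace UnifGrowth

variable {f g : ℝ → (Fin d → ℝ) → ℝ}

theorem add (hf : UnifGrowth Ω f) (hg : UnifGrowth Ω g) :
    UnifGrowth Ω fun ε x => f ε x + g ε x := by
  intro n
  obtain ⟨K, M, hK, h⟩ := hf n
  obtain ⟨K', M', hK', h'⟩ := hg n
  refine ⟨K + K', M + M', by positivity, ?_⟩
  filter_upwards [h, h'] with ε h h'
  exact (h.weaken hK le_rfl (Nat.le_add_right _ _)).add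
    (h'.weaken hK' le_rfl (Nat.le_add_left _ _))

theorem mul (hf : UnifGrowth Ω f) (hg : UnifGrowth Ω g) :
    UnifGrowth Ω fun ε x => f ε x * g ε x := by
  intro n
  obtain ⟨K, M, hK, h⟩ := hf n
  obtain ⟨K', M', hK', h'⟩ := hg n
  refine ⟨2 ^ n * (K * K'), M + M', by positivity, ?_⟩
  filter_upwards [h, h'] with ε h h'
  exact h.mul h' hK hK'

theorem of_continuousAt {c : ℝ → ℝ} (hc : ContinuousAt c 0) : UnifGrowth Ω fun ε _ => c ε := by
  intro n
  refine ⟨|c 0| + 1, 0, by positivity, ?_⟩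
  filter_upwards [hc.abs.eventually (gt_mem_nhds (lt_add_one |c 0|))] with ε h
  exact DerivBound.const _ h.le

theorem coord (l : Fin d) : UnifGrowth Ω fun _ x => x l := fun _ =>
  ⟨1, 1, zero_le_one, Eventually.of_forall fun _ => DerivBound.coord l⟩

theorem sum {ι : Type*} (s : Finset ι) {f : ι → ℝ → (Fin d → ℝ) → ℝ}
    (hf : ∀ i, UnifGrowth Ω (f i)) : UnifGrowth Ω fun ε x => ∑ i ∈ s, f i ε x := by
  classical
  induction s using Finset.induction_on with
  | empty => simpa using of_continuousAt (Ω := Ω) (c := fun _ => 0) continuousAt_const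
  | insert i s hi ih =>
    simp only [Finset.sum_insert hi]
    exact (hf i).add ih

end UnifGrowth

/-- The derivatives of `u` grow at most polynomially on `B (∏ Ω_i)`, uniformly for `B` near `A`. -/
structure GrowthNear (Ω : Fin d → Set ℝ) (A : SpecialLinearGroup (Fin d) ℝ)
    (u : (Fin d → ℝ) → ℝ) : Prop where
  contDiff : ContDiff ℝ ∞ u
  growth : ∀ n : ℕ, ∃ (K : ℝ) (m : ℕ), ∀ᶠ B : SpecialLinearGroup (Fin d) ℝ in 𝓝 A,
    ∀ x ∈ Set.univ.pi Ω,
      ‖iteratedFDeriv ℝ n u ((B : Matrix (Fin d) (Fin d) ℝ) *ᵥ x)‖ ≤ K * (1 + ‖x‖) ^ m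

theorem GrowthNear.fderiv_single {A : SpecialLinearGroup (Fin d) ℝ} {u : (Fin d → ℝ) → ℝ}
    (h : GrowthNear Ω A u) (i : Fin d) :
    GrowthNear Ω A fun y => fderiv ℝ u y (Pi.single i 1) := by
  refine ⟨contDiff_fderiv_single h.contDiff i, fun n => ?_⟩
  obtain ⟨K, m, hK⟩ := h.growth (n + 1)
  refine ⟨K, m, hK.mono fun B hB x hx => ?_⟩
  exact (norm_iteratedFDeriv_fderiv_single_le h.contDiff i n _).trans (hB x hx)

theorem norm_iteratedFDeriv_ridge_le {u : (Fin d → ℝ) → ℝ} (hu : ContDiff ℝ ∞ u)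
    (A : SpecialLinearGroup (Fin d) ℝ) (n : ℕ) (x : Fin d → ℝ) :
    ‖iteratedFDeriv ℝ n (ridge u A) x‖ ≤
      ‖iteratedFDeriv ℝ n u ((A : Matrix (Fin d) (Fin d) ℝ) *ᵥ x)‖ *
        ‖(Matrix.toLin' (A : Matrix (Fin d) (Fin d) ℝ)).toContinuousLinearMap‖ ^ n := by
  set g := (Matrix.toLin' (A : Matrix (Fin d) (Fin d) ℝ)).toContinuousLinearMap
  have e := g.iteratedFDeriv_comp_right hu x (i := n) (by exact_mod_cast le_top)
  have e1 : ridge u A = u ∘ g := rfl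
  rw [e1, e]
  refine (ContinuousMultilinearMap.norm_compContinuousLinearMap_le _ _).trans (le_of_eq ?_)
  rw [Finset.prod_const, Finset.card_univ, Fintype.card_fin]
  rfl

theorem contDiff_ridge {u : (Fin d → ℝ) → ℝ} (hu : ContDiff ℝ ∞ u)
    (A : SpecialLinearGroup (Fin d) ℝ) : ContDiff ℝ ∞ (ridge u A) :=
  hu.comp (Matrix.toLin' (A : Matrix (Fin d) (Fin d) ℝ)).toContinuousLinearMap.contDiff

theorem GrowthNear.unifGrowth_ridge {A : SpecialLinearGroup (Fin d) ℝ} {u : (Fin d → ℝ) → ℝ}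
    (h : GrowthNear Ω A u) {Θ : ℝ → SpecialLinearGroup (Fin d) ℝ}
    (hΘ : ContinuousAt Θ 0) (h0 : Θ 0 = A) : UnifGrowth Ω fun ε => ridge u (Θ ε) := by
  intro n
  have hL : ContinuousAt (fun ε =>
      ‖(Matrix.toLin' (Θ ε : Matrix (Fin d) (Fin d) ℝ)).toContinuousLinearMap‖) 0 := by
    have h1 : Continuous fun B : Matrix (Fin d) (Fin d) ℝ =>
        (Matrix.toLin' B).toContinuousLinearMap := by
      let Λ : Matrix (Fin d) (Fin d) ℝ →ₗ[ℝ] ((Fin d → ℝ) →L[ℝ] (Fin d → ℝ)) :=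
        (Matrix.toLin' ≪≫ₗ LinearMap.toContinuousLinearMap).toLinearMap
      exact Λ.continuous_of_finiteDimensional
    exact (h1.continuousAt.comp (continuous_subtype_val.continuousAt.comp hΘ)).norm
  obtain ⟨Λ, hΛ⟩ : ∃ Λ : ℝ, ∀ᶠ ε in 𝓝 0,
      ‖(Matrix.toLin' (Θ ε : Matrix (Fin d) (Fin d) ℝ)).toContinuousLinearMap‖ < Λ :=
    ⟨_, hL.eventually (gt_mem_nhds (lt_add_one _))⟩
  choose K m hKm using h.growth
  have hev : ∀ᶠ ε in 𝓝 (0 : ℝ), ∀ i ∈ Finset.range (n + 1), ∀ x ∈ Set.univ.pi Ω,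
      ‖iteratedFDeriv ℝ i u ((Θ ε : Matrix (Fin d) (Fin d) ℝ) *ᵥ x)‖ ≤
        K i * (1 + ‖x‖) ^ m i := by
    rw [eventually_all_finset]
    exact fun i _ => (h0 ▸ hΘ : Tendsto Θ (𝓝 0) (𝓝 A)).eventually (hKm i)
  -- Sums over the orders up to `n` dominate each constant and exponent; absolute values are taken
  -- because no sign of `K i` is given.
  refine ⟨∑ i ∈ Finset.range (n + 1), |K i| * |Λ| ^ i, ∑ i ∈ Finset.range (n + 1), m i,
    Finset.sum_nonneg fun i _ => by positivity, ?_⟩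
  filter_upwards [hev, hΛ] with ε h1 h2
  refine ⟨contDiff_ridge h.contDiff _, fun i hi x hx => ?_⟩
  have hi' : i ∈ Finset.range (n + 1) := Finset.mem_range.2 (by omega)
  refine (norm_iteratedFDeriv_ridge_le h.contDiff _ i x).trans ?_
  have h3 : m i ≤ ∑ i ∈ Finset.range (n + 1), m i :=
    Finset.single_le_sum (f := m) (fun _ _ => Nat.zero_le _) hi'
  have h4 : |K i| * |Λ| ^ i ≤ ∑ i ∈ Finset.range (n + 1), |K i| * |Λ| ^ i :=
    Finset.single_le_sum (f := fun i => |K i| * |Λ| ^ i) (fun _ _ => by positivity) hi'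
  calc _ ≤ (|K i| * (1 + ‖x‖) ^ m i) * |Λ| ^ i := by
        gcongr
        · exact (h1 i hi' x hx).trans (by gcongr; exact le_abs_self _)
        · exact h2.le.trans (le_abs_self _)
    _ = (|K i| * |Λ| ^ i) * (1 + ‖x‖) ^ m i := by ring
    _ ≤ (∑ i ∈ Finset.range (n + 1), |K i| * |Λ| ^ i) *
        (1 + ‖x‖) ^ (∑ i ∈ Finset.range (n + 1), m i) := by
        gcongr
        linarith [norm_nonneg x]
    _ ≤ _ := by
        gcongr
        exact one_add_norm_pow_le x _

end Growth

/-! ### Derivatives of the ridge function along a curve -/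

section Velocity

variable {d : ℕ} {Ω : Fin d → Set ℝ}

/-- The derivative of `ε ↦ u (Θ(ε) x)`. -/
noncomputable def ridgeVelocity (Θ : ℝ → SpecialLinearGroup (Fin d) ℝ) (u : (Fin d → ℝ) → ℝ)
    (ε : ℝ) (x : Fin d → ℝ) : ℝ :=
  ∑ j, ∑ l, deriv (fun ε => (Θ ε : Matrix (Fin d) (Fin d) ℝ) j l) ε *
    (x l * ridge (fun y => fderiv ℝ u y (Pi.single j 1)) (Θ ε) x)

/-- The second derivative of `ε ↦ u (Θ(ε) x)`. -/
noncomputable def ridgeAcceleration (Θ : ℝ → SpecialLinearGroup (Fin d) ℝ)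
    (u : (Fin d → ℝ) → ℝ) (ε : ℝ) (x : Fin d → ℝ) : ℝ :=
  ∑ j, ∑ l, (deriv (deriv fun ε => (Θ ε : Matrix (Fin d) (Fin d) ℝ) j l) ε *
      (x l * ridge (fun y => fderiv ℝ u y (Pi.single j 1)) (Θ ε) x) +
    deriv (fun ε => (Θ ε : Matrix (Fin d) (Fin d) ℝ) j l) ε *
      (x l * ridgeVelocity Θ (fun y => fderiv ℝ u y (Pi.single j 1)) ε x))

variable {Θ : ℝ → SpecialLinearGroup (Fin d) ℝ} {u : (Fin d → ℝ) → ℝ}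

theorem fderiv_apply_eq_sum (u : (Fin d → ℝ) → ℝ) (y w : Fin d → ℝ) :
    fderiv ℝ u y w = ∑ j, w j * fderiv ℝ u y (Pi.single j 1) := by
  conv_lhs => rw [pi_eq_sum_univ' w]
  rw [map_sum]
  refine Finset.sum_congr rfl fun j _ => ?_
  rw [map_smul, smul_eq_mul]

theorem hasDerivAt_ridge (hu : ContDiff ℝ ∞ u)
    (hΘ : ∀ j l, ContDiff ℝ ∞ fun ε => (Θ ε : Matrix (Fin d) (Fin d) ℝ) j l) (ε : ℝ)
    (x : Fin d → ℝ) :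
    HasDerivAt (fun ε => ridge u (Θ ε) x) (ridgeVelocity Θ u ε x) ε := by
  have h1 : HasDerivAt (fun ε => (Θ ε : Matrix (Fin d) (Fin d) ℝ) *ᵥ x)
      (fun j => ∑ l, deriv (fun ε => (Θ ε : Matrix (Fin d) (Fin d) ℝ) j l) ε * x l) ε := by
    rw [hasDerivAt_pi]
    intro j
    change HasDerivAt (fun ε => ∑ l, (Θ ε : Matrix (Fin d) (Fin d) ℝ) j l * x l) _ ε
    refine HasDerivAt.fun_sum fun l _ => ?_
    have h2 : Differentiable ℝ fun ε => (Θ ε : Matrix (Fin d) (Fin d) ℝ) j l :=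
      (hΘ j l).differentiable (by simp)
    exact (h2 ε).hasDerivAt.mul_const _
  have h2 := (hu.differentiable (by simp)
    ((Θ ε : Matrix (Fin d) (Fin d) ℝ) *ᵥ x)).hasFDerivAt.comp_hasDerivAt ε h1
  refine h2.congr_deriv ?_
  rw [fderiv_apply_eq_sum]
  simp only [ridgeVelocity, ridge, Finset.sum_mul, mul_assoc]

theorem hasDerivAt_ridgeVelocity (hu : ContDiff ℝ ∞ u)
    (hΘ : ∀ j l, ContDiff ℝ ∞ fun ε => (Θ ε : Matrix (Fin d) (Fin d) ℝ) j l) (ε : ℝ)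
    (x : Fin d → ℝ) :
    HasDerivAt (fun ε => ridgeVelocity Θ u ε x) (ridgeAcceleration Θ u ε x) ε := by
  refine HasDerivAt.fun_sum fun j _ => HasDerivAt.fun_sum fun l _ => ?_
  have h1 : ContDiff ℝ ∞ (deriv fun ε => (Θ ε : Matrix (Fin d) (Fin d) ℝ) j l) :=
    (contDiff_infty_iff_deriv.1 (hΘ j l)).2
  exact (h1.differentiable (by simp) ε).hasDerivAt.mul
    ((hasDerivAt_ridge (contDiff_fderiv_single hu j) hΘ ε x).const_mul (x l))

theorem continuous_of_forall_contDiff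
    (hΘ : ∀ j l, ContDiff ℝ ∞ fun ε => (Θ ε : Matrix (Fin d) (Fin d) ℝ) j l) : Continuous Θ :=
  continuous_induced_rng.2 (continuous_matrix fun j l => (hΘ j l).continuous)

theorem GrowthNear.unifGrowth_ridgeVelocity {A : SpecialLinearGroup (Fin d) ℝ}
    (h : GrowthNear Ω A u)
    (hΘ : ∀ j l, ContDiff ℝ ∞ fun ε => (Θ ε : Matrix (Fin d) (Fin d) ℝ) j l) (h0 : Θ 0 = A) :
    UnifGrowth Ω (ridgeVelocity Θ u) := by
  refine UnifGrowth.sum _ fun j => UnifGrowth.sum _ fun l => ?_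
  refine UnifGrowth.mul (UnifGrowth.of_continuousAt ?_) ((UnifGrowth.coord l).mul ?_)
  · exact (contDiff_infty_iff_deriv.1 (hΘ j l)).2.continuous.continuousAt
  · exact (h.fderiv_single j).unifGrowth_ridge
      (continuous_of_forall_contDiff hΘ).continuousAt h0

theorem GrowthNear.unifGrowth_ridgeAcceleration {A : SpecialLinearGroup (Fin d) ℝ}
    (h : GrowthNear Ω A u)
    (hΘ : ∀ j l, ContDiff ℝ ∞ fun ε => (Θ ε : Matrix (Fin d) (Fin d) ℝ) j l) (h0 : Θ 0 = A) :
    UnifGrowth Ω (ridgeAcceleration Θ u) := by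
  refine UnifGrowth.sum _ fun j => UnifGrowth.sum _ fun l => ?_
  have h1 : ContDiff ℝ ∞ (deriv fun ε => (Θ ε : Matrix (Fin d) (Fin d) ℝ) j l) :=
    (contDiff_infty_iff_deriv.1 (hΘ j l)).2
  refine UnifGrowth.add ?_ ?_
  · refine UnifGrowth.mul (UnifGrowth.of_continuousAt ?_) ((UnifGrowth.coord l).mul ?_)
    · exact (contDiff_infty_iff_deriv.1 h1).2.continuous.continuousAt
    · exact (h.fderiv_single j).unifGrowth_ridge
        (continuous_of_forall_contDiff hΘ).continuousAt h0
  · refine UnifGrowth.mul (UnifGrowth.of_continuousAt h1.continuous.continuousAt)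
      ((UnifGrowth.coord l).mul ?_)
    exact (h.fderiv_single j).unifGrowth_ridgeVelocity hΘ h0

/-! ### Differentiation under the integral sign and Taylor's formula -/

variable {μ : Fin d → Measure ℝ} [∀ i, IsFiniteMeasure (μ i)]

theorem DerivBound.memLp (hμΩ : ∀ i, μ i (Ω i)ᶜ = 0)
    (hμ : ∀ i (n : ℕ), Integrable (fun t : ℝ => |t| ^ n) (μ i)) {K : ℝ} {M n : ℕ}
    {f : (Fin d → ℝ) → ℝ} (hf : DerivBound Ω K M n f) : MemLp f 2 (prodMeasure μ) := by
  refine MemLp.mono' ((memLp_prod_one_add_abs_pow hμ M).const_mul K)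
    hf.contDiff.continuous.aestronglyMeasurable ?_
  filter_upwards [ae_mem_pi hμΩ] with x hx
  exact hf.abs_le hx

/-- The quantifier over `g` stands inside `∀ᶠ`, so that one neighbourhood of `0` serves all terms of
an orthogonalization at once. -/
theorem UnifGrowth.eventually_hasDerivAt_integral_mul (hμΩ : ∀ i, μ i (Ω i)ᶜ = 0)
    (hμ : ∀ i (n : ℕ), Integrable (fun t : ℝ => |t| ^ n) (μ i)) {f f' : ℝ → (Fin d → ℝ) → ℝ}
    (hf : UnifGrowth Ω f) (hf' : UnifGrowth Ω f')
    (hd : ∀ ε x, HasDerivAt (fun ε => f ε x) (f' ε x) ε) :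
    ∀ᶠ ε in 𝓝 0, ∀ g, MemLp g 2 (prodMeasure μ) →
      HasDerivAt (fun ε => ∫ x, f ε x * g x ∂(prodMeasure μ))
        (∫ x, f' ε x * g x ∂(prodMeasure μ)) ε := by
  obtain ⟨K, M, hK, h⟩ := hf 0
  obtain ⟨K', M', hK', h'⟩ := hf' 0
  filter_upwards [(h.and h').eventually_nhds] with ε hε g hg
  have hint : Integrable (fun x => K' * (∏ j, (1 + |x j|) ^ M') * |g x|) (prodMeasure μ) :=
    ((memLp_prod_one_add_abs_pow hμ M').const_mul K').integrable_mul hg.abs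
  refine (hasDerivAt_integral_of_dominated_loc_of_deriv_le (F := fun ε x => f ε x * g x)
    (F' := fun ε x => f' ε x * g x) hε ?_ ?_ ?_ ?_ hint ?_).2
  · filter_upwards [hε] with η hη
    exact hη.1.contDiff.continuous.aestronglyMeasurable.mul hg.1
  · exact (hε.self_of_nhds.1.memLp hμΩ hμ).integrable_mul hg
  · exact hε.self_of_nhds.2.contDiff.continuous.aestronglyMeasurable.mul hg.1
  · filter_upwards [ae_mem_pi hμΩ] with x hx η hη
    rw [norm_mul]
    exact mul_le_mul_of_nonneg_right (hη.2.abs_le hx) (norm_nonneg _)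
  · exact Eventually.of_forall fun x η _ => (hd η x).mul_const _

/-- The mean value inequality is used twice, for `φ'` and then for `φ η - η φ' 0`. The constant `C`
instead of `C / 2` is harmless, and `φ''` need not be continuous. -/
theorem abs_sub_sub_mul_le_mul_sq {φ φ' φ'' : ℝ → ℝ} {δ C : ℝ}
    (h1 : ∀ ε ∈ Metric.ball (0 : ℝ) δ, HasDerivAt φ (φ' ε) ε)
    (h2 : ∀ ε ∈ Metric.ball (0 : ℝ) δ, HasDerivAt φ' (φ'' ε) ε)
    (hC : ∀ ε ∈ Metric.ball (0 : ℝ) δ, |φ'' ε| ≤ C) :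
    ∀ ε ∈ Metric.ball (0 : ℝ) δ, |φ ε - φ 0 - ε * φ' 0| ≤ C * ε ^ 2 := by
  intro ε hε
  have hδ : 0 < δ := Metric.pos_of_mem_ball hε
  have h0 : (0 : ℝ) ∈ Metric.ball (0 : ℝ) δ := Metric.mem_ball_self hδ
  have hC0 : 0 ≤ C := (abs_nonneg _).trans (hC 0 h0)
  have hd : ∀ η ∈ Metric.ball (0 : ℝ) δ, |φ' η - φ' 0| ≤ C * |η| := by
    intro η hη
    have := (convex_ball (0 : ℝ) δ).norm_image_sub_le_of_norm_hasDerivWithin_le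
      (fun x hx => (h2 x hx).hasDerivWithinAt) hC h0 hη
    simpa using this
  have hsub : Set.uIcc 0 ε ⊆ Metric.ball (0 : ℝ) δ := by
    rw [← segment_eq_uIcc]
    exact (convex_ball (0 : ℝ) δ).segment_subset h0 hε
  have hψ : ∀ η ∈ Set.uIcc 0 ε, HasDerivWithinAt (fun η => φ η - η * φ' 0) (φ' η - φ' 0)
      (Set.uIcc 0 ε) η := by
    intro η hη
    simpa using ((h1 η (hsub hη)).fun_sub
      ((hasDerivAt_id' η).mul_const (φ' 0))).hasDerivWithinAt (s := Set.uIcc 0 ε)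
  have hb : ∀ η ∈ Set.uIcc 0 ε, ‖φ' η - φ' 0‖ ≤ C * |ε| := by
    intro η hη
    refine (hd η (hsub hη)).trans (mul_le_mul_of_nonneg_left ?_ hC0)
    simpa using Set.abs_sub_left_of_mem_uIcc hη
  have := (convex_uIcc 0 ε).norm_image_sub_le_of_norm_hasDerivWithin_le hψ hb
    Set.left_mem_uIcc Set.right_mem_uIcc
  simp only [zero_mul, sub_zero, Real.norm_eq_abs] at this
  calc |φ ε - φ 0 - ε * φ' 0| = |φ ε - ε * φ' 0 - φ 0| := by ring_nf
    _ ≤ C * |ε| * |ε| := this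
    _ = C * ε ^ 2 := by rw [mul_assoc, abs_mul_abs_self, sq]

end Velocity

/-! ### The derivative of the cost along curves -/

theorem singularSum_ne_top {d : ℕ} {μ : Fin d → Measure ℝ} {v : (Fin d → ℝ) → ℝ} (h : totalSingularSum μ v ≠ ⊤)
    (i : Fin (d - 1)) : singularSum μ ((i : ℕ) + 1) v ≠ ⊤ := by
  rw [totalSingularSum, ENNReal.sum_ne_top] at h
  exact h i (Finset.mem_univ i)

section Derivative

variable {d : ℕ} {Ω : Fin d → Set ℝ} {μ : Fin d → Measure ℝ} [∀ i, IsFiniteMeasure (μ i)]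
  {u : (Fin d → ℝ) → ℝ} {A : SpecialLinearGroup (Fin d) ℝ}

/-- The entries are polynomial in the coordinates and the first derivatives of `u` at `A x`, so the
closure properties of `UnifGrowth` apply to families constant in `ε`. -/
theorem GrowthNear.exists_derivBound_descentMatrix (h : GrowthNear Ω A u) (j l : Fin d) :
    ∃ (K : ℝ) (M : ℕ), 0 ≤ K ∧ DerivBound Ω K M d fun x => descentMatrix u A x j l := by
  have hg : ∀ j, UnifGrowth Ω fun _ x =>
      ridge (fun y => fderiv ℝ u y (Pi.single j 1)) A x := fun j =>
    (h.fderiv_single j).unifGrowth_ridge (Θ := fun _ => A) continuousAt_const rfl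
  have hy : ∀ l, UnifGrowth Ω fun _ x => ((A : Matrix (Fin d) (Fin d) ℝ) *ᵥ x) l := fun l =>
    UnifGrowth.sum Finset.univ (f := fun m _ x => (A : Matrix (Fin d) (Fin d) ℝ) l m * x m)
      fun m => (UnifGrowth.of_continuousAt (c := fun _ => (A : Matrix (Fin d) (Fin d) ℝ) l m)
        continuousAt_const).mul (UnifGrowth.coord m)
  have hs : UnifGrowth Ω fun _ x => grad u ((A : Matrix (Fin d) (Fin d) ℝ) *ᵥ x) ⬝ᵥ
      ((A : Matrix (Fin d) (Fin d) ℝ) *ᵥ x) :=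
    UnifGrowth.sum Finset.univ (f := fun m _ x =>
      ridge (fun y => fderiv ℝ u y (Pi.single m 1)) A x *
        ((A : Matrix (Fin d) (Fin d) ℝ) *ᵥ x) m) fun m => (hg m).mul (hy m)
  have hall : UnifGrowth Ω fun _ x => descentMatrix u A x j l := by
    have h1 := ((hg j).mul (hy l)).add (hs.mul (UnifGrowth.of_continuousAt
      (c := fun _ => -((d : ℝ)⁻¹ * (1 : Matrix (Fin d) (Fin d) ℝ) j l)) continuousAt_const))
    convert h1 using 3 with ε x
    simp only [descentMatrix, Matrix.sub_apply, vecMulVec_apply, Matrix.smul_apply, smul_eq_mul,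
      ridge, grad]
    ring
  obtain ⟨K, M, hK, hev⟩ := hall d
  exact ⟨K, M, hK, hev.self_of_nhds⟩

theorem DerivBound.summable_integral_mul_term {k : ℕ} {v : (Fin d → ℝ) → ℝ}
    (hΩ : ∀ i, (Ω i).OrdConnected) (hμΩ : ∀ i, μ i (Ω i)ᶜ = 0)
    (hμ : ∀ i (n : ℕ), Integrable (fun t : ℝ => |t| ^ n) (μ i))
    (O : FTTOrthogonalization μ v k) {K : ℝ} (hK : 0 ≤ K) {M : ℕ} {f : (Fin d → ℝ) → ℝ}
    (hf : DerivBound Ω K M d f) :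
    Summable fun α => ∫ x, f x * O.term α x ∂(prodMeasure μ) := by
  obtain ⟨C, hC⟩ := exists_sum_abs_integral_mul_term_le hΩ hμΩ hμ O hK M
  exact (summable_of_sum_le (fun α => abs_nonneg _) (hC f hf)).of_abs

/-- The orthogonalization at `ε = 0` supplies a competitor in the dual problem at every `ε`. The
pairing is expanded to second order for finite `F`, with a remainder independent of `F`, and then
`F` exhausts the index set. -/
theorem exists_singularSum_lower_bound (hΩ : ∀ i, (Ω i).OrdConnected)
    (hμΩ : ∀ i, μ i (Ω i)ᶜ = 0)
    (hμ : ∀ i (n : ℕ), Integrable (fun t : ℝ => |t| ^ n) (μ i)) (hu : GrowthNear Ω A u) {k : ℕ}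
    (O : FTTOrthogonalization μ (ridge u A) k) {Θ : ℝ → SpecialLinearGroup (Fin d) ℝ}
    (hΘ : ∀ j l, ContDiff ℝ ∞ fun ε => (Θ ε : Matrix (Fin d) (Fin d) ℝ) j l) (h0 : Θ 0 = A)
    (hfin : ∀ᶠ ε in 𝓝 (0 : ℝ), singularSum μ k (ridge u (Θ ε)) ≠ ⊤) :
    ∃ C, ∀ᶠ ε in 𝓝 (0 : ℝ), (singularSum μ k (ridge u (Θ 0))).toReal +
      ε * (∑' α, ∫ x, ridgeVelocity Θ u 0 x * O.term α x ∂(prodMeasure μ)) - C * ε ^ 2 ≤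
        (singularSum μ k (ridge u (Θ ε))).toReal := by
  subst h0
  have g0 : UnifGrowth Ω fun ε => ridge u (Θ ε) :=
    hu.unifGrowth_ridge (continuous_of_forall_contDiff hΘ).continuousAt rfl
  have g1 := hu.unifGrowth_ridgeVelocity hΘ rfl
  have g2 := hu.unifGrowth_ridgeAcceleration hΘ rfl
  obtain ⟨K₁, M₁, hK₁, hb₁⟩ := g1 d
  obtain ⟨K₂, M₂, hK₂, hb₂⟩ := g2 d
  have hsum := hb₁.self_of_nhds.summable_integral_mul_term hΩ hμΩ hμ O hK₁
  obtain ⟨C, hC⟩ := exists_sum_abs_integral_mul_term_le hΩ hμΩ hμ O hK₂ M₂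
  have hd₁ := g0.eventually_hasDerivAt_integral_mul hμΩ hμ g1
    (hasDerivAt_ridge hu.contDiff hΘ)
  have hd₂ := g1.eventually_hasDerivAt_integral_mul hμΩ hμ g2
    (hasDerivAt_ridgeVelocity hu.contDiff hΘ)
  obtain ⟨δ, hδ, hball⟩ := Metric.eventually_nhds_iff_ball.1 (hb₂.and (hd₁.and (hd₂.and hfin)))
  refine ⟨C, ?_⟩
  filter_upwards [Metric.ball_mem_nhds 0 hδ] with ε hε
  have hfin0 : singularSum μ k (ridge u (Θ 0)) ≠ ⊤ := hfin.self_of_nhds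
  have hlim := (((O.summable_σ hfin0).hasSum.add (hsum.hasSum.mul_left ε))).sub_const (C * ε ^ 2)
  rw [O.singularSum_toReal hfin0]
  refine le_of_tendsto hlim (Eventually.of_forall fun F => ?_)
  have hT := abs_sub_sub_mul_le_mul_sq (δ := δ) (C := C)
    (φ := fun ε => ∑ α ∈ F, ∫ x, ridge u (Θ ε) x * O.term α x ∂(prodMeasure μ))
    (φ' := fun ε => ∑ α ∈ F, ∫ x, ridgeVelocity Θ u ε x * O.term α x ∂(prodMeasure μ))
    (φ'' := fun ε => ∑ α ∈ F, ∫ x, ridgeAcceleration Θ u ε x * O.term α x ∂(prodMeasure μ))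
    (fun η hη => HasDerivAt.fun_sum fun α _ => (hball η hη).2.1 _ (O.memLp_term α))
    (fun η hη => HasDerivAt.fun_sum fun α _ => (hball η hη).2.2.1 _ (O.memLp_term α))
    (fun η hη => (Finset.abs_sum_le_sum_abs _ _).trans (hC _ (hball η hη).1 F)) ε hε
  have hup := O.sum_integral_mul_term_le_singularSum (hball ε hε).2.2.2 F
  simp only [O.integral_mul_term] at hT
  have := (abs_le.1 hT).1
  rw [Finset.sum_add_distrib, ← Finset.mul_sum]
  linarith

/-- A differentiable function touched from below by a differentiable one has the same derivative at
the contact point. -/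
theorem hasDerivAt_cost (hΩ : ∀ i, (Ω i).OrdConnected)
    (hμΩ : ∀ i, μ i (Ω i)ᶜ = 0)
    (hμ : ∀ i (n : ℕ), Integrable (fun t : ℝ => |t| ^ n) (μ i)) (hu : GrowthNear Ω A u)
    (hfin : ∀ᶠ B in 𝓝 A, totalSingularSum μ (ridge u B) ≠ ⊤)
    (O : ∀ i : Fin (d - 1), FTTOrthogonalization μ (ridge u A) ((i : ℕ) + 1))
    {Θ : ℝ → SpecialLinearGroup (Fin d) ℝ}
    (hΘ : ∀ j l, ContDiff ℝ ∞ fun ε => (Θ ε : Matrix (Fin d) (Fin d) ℝ) j l) (h0 : Θ 0 = A)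
    (hC : DifferentiableAt ℝ (fun ε => cost μ u (Θ ε)) 0) :
    HasDerivAt (fun ε => cost μ u (Θ ε))
      (∑ i, ∑' α, ∫ x, ridgeVelocity Θ u 0 x * (O i).term α x ∂(prodMeasure μ)) 0 := by
  have hcont : Tendsto Θ (𝓝 0) (𝓝 A) := h0 ▸ (continuous_of_forall_contDiff hΘ).continuousAt
  have hfin' := hcont.eventually hfin
  have hcost : ∀ᶠ ε in 𝓝 (0 : ℝ), cost μ u (Θ ε) =
      ∑ i : Fin (d - 1), (singularSum μ ((i : ℕ) + 1) (ridge u (Θ ε))).toReal := by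
    filter_upwards [hfin'] with ε hε
    rw [cost, totalSingularSum, ENNReal.toReal_sum fun i _ => singularSum_ne_top hε i]
  choose C hlow using fun i : Fin (d - 1) => exists_singularSum_lower_bound hΩ hμΩ hμ hu (O i) hΘ h0
    (hfin'.mono fun ε hε => singularSum_ne_top hε i)
  set ℓ := ∑ i, ∑' α, ∫ x, ridgeVelocity Θ u 0 x * (O i).term α x ∂(prodMeasure μ) with hℓ
  -- The lower bounds, summed over `k`, say exactly that the difference to the touching parabola is
  -- minimal at `0`.
  have hmin : IsLocalMin (fun ε => cost μ u (Θ ε) - ε * ℓ + (∑ i, C i) * ε ^ 2) 0 := by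
    filter_upwards [hcost, eventually_all.2 hlow] with ε h1 h2
    have h3 := Finset.sum_le_sum fun i (_ : i ∈ Finset.univ) => h2 i
    rw [Finset.sum_sub_distrib, Finset.sum_add_distrib, ← Finset.mul_sum, ← hℓ,
      ← Finset.sum_mul, ← h1, ← hcost.self_of_nhds] at h3
    simp only [zero_mul, sub_zero, ne_eq, OfNat.ofNat_ne_zero, not_false_eq_true, zero_pow,
      mul_zero, add_zero]
    linarith
  have hd := (hC.hasDerivAt.sub ((hasDerivAt_id' (0 : ℝ)).mul_const ℓ)).add
    (((hasDerivAt_id' (0 : ℝ)).pow 2).const_mul (∑ i, C i))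
  have hz := hmin.hasDerivAt_eq_zero hd
  have : deriv (fun ε => cost μ u (Θ ε)) 0 = ℓ := by
    simp at hz
    linarith
  exact this ▸ hC.hasDerivAt

end Derivative

/-! ### Linear algebra of the tangent space -/

section Tangent

variable {d : ℕ}

theorem metricSL_mul_mul (A : SpecialLinearGroup (Fin d) ℝ) (D N : Matrix (Fin d) (Fin d) ℝ) :
    metricSL A (D * (A : Matrix (Fin d) (Fin d) ℝ)) (N * (A : Matrix (Fin d) (Fin d) ℝ)) =
      ∑ j, ∑ l, N j l * D j l := by
  have hA : IsUnit (A : Matrix (Fin d) (Fin d) ℝ).det := by simp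
  rw [metricSL, Matrix.mul_nonsing_inv_cancel_right _ _ hA,
    Matrix.mul_nonsing_inv_cancel_right _ _ hA, Matrix.trace]
  simp only [diag_apply, mul_apply, transpose_apply, mul_comm]

/-- The matrices `v wᵀ` with `w ⬝ᵥ v = 0` span the traceless ones: pairs of basis vectors detect the
off-diagonal entries, and `e_j + e_l` with `e_j - e_l` the differences of diagonal entries. -/
theorem eq_zero_of_dotProduct_mulVec_eq_zero {H : Matrix (Fin d) (Fin d) ℝ} (htr : H.trace = 0)
    (h : ∀ v w : Fin d → ℝ, w ⬝ᵥ v = 0 → v ⬝ᵥ H *ᵥ w = 0) : H = 0 := by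
  have hoff : ∀ j l, j ≠ l → H j l = 0 := by
    intro j l hjl
    have := h (Pi.single j 1) (Pi.single l 1) (by simp [hjl])
    simpa using this
  have hdiag : ∀ j l, H j j = H l l := by
    intro j l
    by_cases hjl : j = l
    · rw [hjl]
    · have := h (Pi.single j 1 + Pi.single l 1) (Pi.single j 1 - Pi.single l 1)
        (by simp [hjl, Ne.symm hjl])
      simp [mulVec_sub, hoff j l hjl, hoff l j (Ne.symm hjl)] at this
      linarith
  ext j l
  by_cases hjl : j = l
  · subst hjl
    have e : H.trace = d * H j j := by
      simp only [Matrix.trace, diag_apply, hdiag _ j]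
      simp
    have hd : (d : ℝ) ≠ 0 := by
      have := j.pos
      positivity
    rw [htr] at e
    simpa [hd] using e.symm
  · exact hoff j l hjl

/-- The determinant of `1 + ε v wᵀ` is `1 + ε (w ⬝ᵥ v) = 1`, so the straight line through `A` stays
in the group and no matrix exponential is needed. -/
theorem exists_isSmoothCurveThrough_vecMulVec (A : SpecialLinearGroup (Fin d) ℝ)
    {v w : Fin d → ℝ} (hvw : w ⬝ᵥ v = 0) :
    ∃ Θ, IsSmoothCurveThrough Θ A (vecMulVec v w * (A : Matrix (Fin d) (Fin d) ℝ)) := by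
  have hdet : ∀ ε : ℝ, (1 + ε • vecMulVec v w).det = 1 := by
    intro ε
    rw [← smul_vecMulVec, vecMulVec_eq Unit, det_one_add_replicateCol_mul_replicateRow]
    simp [hvw]
  let B : ℝ → SpecialLinearGroup (Fin d) ℝ := fun ε => ⟨_, hdet ε⟩
  have e : ∀ (ε : ℝ) (j l : Fin d), ((B ε * A : SpecialLinearGroup (Fin d) ℝ) :
      Matrix (Fin d) (Fin d) ℝ) j l = (A : Matrix (Fin d) (Fin d) ℝ) j l +
        ε * (vecMulVec v w * (A : Matrix (Fin d) (Fin d) ℝ)) j l := by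
    intro ε j l
    change ((1 + ε • vecMulVec v w) * (A : Matrix (Fin d) (Fin d) ℝ)) j l = _
    simp [Matrix.add_mul]
  refine ⟨fun ε => B ε * A, fun j l => ?_, ?_, fun j l => ?_⟩
  · simp only [e]
    fun_prop
  · ext j l
    simp [e]
  · simp only [e]
    simp

theorem IsRiemannianGradient.unique {f : SpecialLinearGroup (Fin d) ℝ → ℝ}
    {A : SpecialLinearGroup (Fin d) ℝ} {G G' : Matrix (Fin d) (Fin d) ℝ}
    (hG : IsRiemannianGradient f A G) (hG' : IsRiemannianGradient f A G') : G = G' := by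
  obtain ⟨⟨N, hN, rfl⟩, h⟩ := hG
  obtain ⟨⟨N', hN', rfl⟩, h'⟩ := hG'
  suffices N - N' = 0 by rw [sub_eq_zero.1 this]
  refine eq_zero_of_dotProduct_mulVec_eq_zero (by rw [trace_sub, hN, hN', sub_zero]) ?_
  intro v w hvw
  obtain ⟨Θ, hΘ⟩ := exists_isSmoothCurveThrough_vecMulVec A hvw
  have hV : vecMulVec v w * (A : Matrix (Fin d) (Fin d) ℝ) ∈ tangentSL A :=
    ⟨_, by rw [trace_vecMulVec, dotProduct_comm, hvw], rfl⟩
  have e := (h _ hV Θ hΘ).unique (h' _ hV Θ hΘ)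
  rw [metricSL_mul_mul, metricSL_mul_mul] at e
  rw [sub_mulVec, dotProduct_sub, sub_eq_zero]
  have k : ∀ P : Matrix (Fin d) (Fin d) ℝ,
      v ⬝ᵥ P *ᵥ w = ∑ j, ∑ l, vecMulVec v w j l * P j l := by
    intro P
    simp only [dotProduct, mulVec, Finset.mul_sum, vecMulVec_apply]
    exact Finset.sum_congr rfl fun j _ => Finset.sum_congr rfl fun l _ => by ring
  rw [k, k, e]

/-- The velocity is `gᵀ N A x`, the pairing of `N` with `g (A x)ᵀ`; subtracting a multiple of the
identity changes nothing because `N` is traceless. -/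
theorem ridgeVelocity_eq_sum_descentMatrix {u : (Fin d → ℝ) → ℝ}
    {A : SpecialLinearGroup (Fin d) ℝ} {Θ : ℝ → SpecialLinearGroup (Fin d) ℝ}
    {N : Matrix (Fin d) (Fin d) ℝ} (hN : N.trace = 0)
    (hΘ : IsSmoothCurveThrough Θ A (N * (A : Matrix (Fin d) (Fin d) ℝ))) (x : Fin d → ℝ) :
    ridgeVelocity Θ u 0 x = ∑ j, ∑ l, N j l * descentMatrix u A x j l := by
  set y := (A : Matrix (Fin d) (Fin d) ℝ) *ᵥ x with hy
  have h1 : ridgeVelocity Θ u 0 x = ∑ j, (N *ᵥ y) j * grad u y j := by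
    rw [hy, mulVec_mulVec]
    simp only [ridgeVelocity, hΘ.2.1, hΘ.2.2, mulVec, dotProduct, Finset.sum_mul, ridge, grad,
      mul_assoc]
  have h2 : ∀ j, ∑ l, N j l * descentMatrix u A x j l =
      (N *ᵥ y) j * grad u y j - (grad u y ⬝ᵥ y / d) * N j j := by
    intro j
    have hM : ∀ l, descentMatrix u A x j l = grad u y j * y l -
        (grad u y ⬝ᵥ y / d) * (1 : Matrix (Fin d) (Fin d) ℝ) j l := fun l => by
      simp [descentMatrix, vecMulVec_apply, hy]
    generalize grad u y ⬝ᵥ y / d = s at hM ⊢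
    simp only [hM, Matrix.one_apply, mul_sub, Finset.sum_sub_distrib, mul_ite, mul_one, mul_zero,
      Finset.sum_ite_eq, Finset.mem_univ, if_true]
    rw [mulVec, dotProduct, Finset.sum_mul]
    congr 1
    · exact Finset.sum_congr rfl fun l _ => by ring
    · ring
  simp only [h2, Finset.sum_sub_distrib, ← Finset.mul_sum, h1]
  have : ∑ j, N j j = 0 := hN
  rw [this, mul_zero, sub_zero]

theorem trace_descentMatrix (u : (Fin d → ℝ) → ℝ) (A : SpecialLinearGroup (Fin d) ℝ)
    (x : Fin d → ℝ) : (descentMatrix u A x).trace = 0 := by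
  rcases Nat.eq_zero_or_pos d with rfl | hd
  · simp [Matrix.trace]
  · have : (d : ℝ) ≠ 0 := by positivity
    simp only [descentMatrix, trace_sub, trace_vecMulVec, trace_smul, trace_one, Fintype.card_fin,
      smul_eq_mul]
    field_simp
    ring

end Tangent

/-! ### The Riemannian gradient of the cost -/

theorem proposition1 {d : ℕ}
    -- the domain `Ω = Ω_1 × ⋯ × Ω_d` and the finite measures `μ_i` on `Ω_i`, with finite moments
    (Ω : Fin d → Set ℝ) (hΩ : ∀ i, (Ω i).OrdConnected)
    (μ : Fin d → Measure ℝ) [∀ i, IsFiniteMeasure (μ i)] (hμΩ : ∀ i, μ i (Ω i)ᶜ = 0)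
    (hμ : ∀ i (n : ℕ), Integrable (fun t : ℝ => |t| ^ n) (μ i))
    (u : (Fin d → ℝ) → ℝ) (A : SpecialLinearGroup (Fin d) ℝ)
    -- `u` is smooth; its derivatives grow at most polynomially on `B Ω`, for `B` near `A`
    (hu : ContDiff ℝ ∞ u)
    (hgrowth : ∀ n : ℕ, ∃ (K : ℝ) (m : ℕ), ∀ᶠ B : SpecialLinearGroup (Fin d) ℝ in 𝓝 A, ∀ x ∈ Set.univ.pi Ω,
      ‖iteratedFDeriv ℝ n u ((B : Matrix (Fin d) (Fin d) ℝ) *ᵥ x)‖ ≤ K * (1 + ‖x‖) ^ m)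
    -- the cost is finite near `A` and differentiable at `A`
    (hfin : ∀ᶠ B in 𝓝 A, totalSingularSum μ (ridge u B) ≠ ⊤)
    (hC : DifferentiableAlongCurves (cost μ u) A)
    -- any orthogonalizations of `v = u ∘ A`
    (O : ∀ i : Fin (d - 1), FTTOrthogonalization μ (ridge u A) ((i : ℕ) + 1)) :
    (∀ i α j l, Integrable (descentTerm (O i) u A α j l) (prodMeasure μ)) ∧
    (∀ i j l, Summable fun α => ∫ x, descentTerm (O i) u A α j l x ∂(prodMeasure μ)) ∧
    (descentGenerator u A O).trace = 0 ∧
    IsRiemannianGradient (cost μ u) A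
      (descentGenerator u A O * (A : Matrix (Fin d) (Fin d) ℝ)) ∧
    ∀ G, IsRiemannianGradient (cost μ u) A G →
      G = descentGenerator u A O * (A : Matrix (Fin d) (Fin d) ℝ) := by
  have hg : GrowthNear Ω A u := ⟨hu, hgrowth⟩
  have hterm : ∀ i α j l, descentTerm (O i) u A α j l =
      fun x => descentMatrix u A x j l * (O i).term α x := fun i α j l => by
    ext x
    rw [mul_comm]
    rfl
  have hint : ∀ i α j l, Integrable (descentTerm (O i) u A α j l) (prodMeasure μ) := by
    intro i α j l
    obtain ⟨K, M, -, hb⟩ := hg.exists_derivBound_descentMatrix j l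
    rw [hterm]
    exact (hb.memLp hμΩ hμ).integrable_mul ((O i).memLp_term α)
  have hsum : ∀ i j l,
      Summable fun α => ∫ x, descentTerm (O i) u A α j l x ∂(prodMeasure μ) := by
    intro i j l
    obtain ⟨K, M, hK, hb⟩ := hg.exists_derivBound_descentMatrix j l
    simp only [hterm]
    exact hb.summable_integral_mul_term hΩ hμΩ hμ (O i) hK
  -- No trace condition on `N` here: traceless `N` will give the derivative of the cost, and `N = 1`
  -- the trace of `D`.
  have hlin : ∀ N : Fin d → Fin d → ℝ, ∑ j, ∑ l, N j l * descentGenerator u A O j l =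
      ∑ i, ∑' α, ∫ x, (∑ j, ∑ l, N j l * descentMatrix u A x j l) * (O i).term α x
        ∂(prodMeasure μ) := by
    intro N
    have h1 : ∀ i α, ∫ x, (∑ j, ∑ l, N j l * descentMatrix u A x j l) * (O i).term α x
        ∂(prodMeasure μ) =
        ∑ j, ∑ l, N j l * ∫ x, descentTerm (O i) u A α j l x ∂(prodMeasure μ) := by
      intro i α
      have h2 : ∀ x, (∑ j, ∑ l, N j l * descentMatrix u A x j l) * (O i).term α x =
          ∑ j, ∑ l, N j l * descentTerm (O i) u A α j l x := fun x => by
        simp only [hterm, Finset.sum_mul, mul_assoc]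
      simp only [h2]
      rw [integral_finsetSum _ fun j _ => integrable_finsetSum _ fun l _ =>
        (hint i α j l).const_mul _]
      refine Finset.sum_congr rfl fun j _ => ?_
      rw [integral_finsetSum _ fun l _ => (hint i α j l).const_mul _]
      simp only [integral_const_mul]
    have h3 : ∀ i, ∑' α, ∫ x, (∑ j, ∑ l, N j l * descentMatrix u A x j l) * (O i).term α x
        ∂(prodMeasure μ) =
        ∑ j, ∑ l, N j l * ∑' α, ∫ x, descentTerm (O i) u A α j l x ∂(prodMeasure μ) := by
      intro i
      simp only [h1]
      exact (hasSum_sum fun j _ => hasSum_sum fun l _ =>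
        (hsum i j l).hasSum.mul_left (N j l)).tsum_eq
    simp only [h3, descentGenerator, Matrix.of_apply, Finset.mul_sum]
    symm
    rw [Finset.sum_comm]
    refine Finset.sum_congr rfl fun j _ => ?_
    rw [Finset.sum_comm]
  have htr : (descentGenerator u A O).trace = 0 := by
    have h1 := hlin fun j l => (1 : Matrix (Fin d) (Fin d) ℝ) j l
    have h2 : ∀ D : Matrix (Fin d) (Fin d) ℝ,
        ∑ j, ∑ l, (1 : Matrix (Fin d) (Fin d) ℝ) j l * D j l = D.trace := fun D => by
      simp [Matrix.one_apply, Matrix.trace]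
    simpa only [h2, trace_descentMatrix, zero_mul, integral_zero, tsum_zero,
      Finset.sum_const_zero] using h1
  have hgrad : IsRiemannianGradient (cost μ u) A
      (descentGenerator u A O * (A : Matrix (Fin d) (Fin d) ℝ)) := by
    refine ⟨⟨_, htr, rfl⟩, ?_⟩
    rintro V ⟨N, hN, rfl⟩ Θ hΘ
    have h1 := hasDerivAt_cost hΩ hμΩ hμ hg hfin O hΘ.1 hΘ.2.1 (hC _ Θ hΘ)
    simp only [ridgeVelocity_eq_sum_descentMatrix hN hΘ] at h1
    rwa [metricSL_mul_mul, hlin fun j l => N j l]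
  exact ⟨hint, hsum, htr, hgrad, fun G hG => hG.unique hgrad⟩
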